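/- **Theorem 2.11.** Let $k$ be a field and let $Q$ be a non-split quaternion algebra over $k$, i.e. a central simple $k$-algebra of dimension $4$ which is not isomorphic to $M_2(k)$. Then there exist an algebraic function field of one variable $K$ with (full) constant field $k$, which has genus $0$ and is not $k$-isomorphic to the rational function field $k(t)$, a place $\infty$ of $K$ of degree $2$, and a vertex $v$ of the Bruhat–Tits tree of $GL_2(K_\infty)$ such that the stabilizer of $v$ in $GL_2(\mathcal{C})$ is isomorphic, as a group, to the unit group $Q^*$. Here $K_\infty$ is the completion of $K$ at $\infty$, with valuation ring $\mathcal{O}_\infty$; $\mathcal{C}$ is the ring of all elements of $K$ which are integral at every place other than $\infty$; the vertices of the tree are the left cosets in $GL_2(K_\infty)$ of the subgroup generated by the scalar matrices and $GL_2(\mathcal{O}_\infty)$; and $GL_2(\mathcal{C})$ acts on them by left multiplication. Moreover $K$ and $\infty$ can be chosen so that, in addition, the following holds. * If $\mathrm{char}(k)\neq 2$, there are $\rho,\sigma\in k$ such that $Q$ has a $k$-basis $1,i,j,ij$ with $i^2=-\rho$, $j^2=-\sigma$, $ij=-ji$, and $\mathcal{C}$ is isomorphic as a $k$-algebra to $k[X,Y]/(Y^2+\rho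 X^2+\sigma)$. * If $\mathrm{char}(k)=2$, there are $\rho,\sigma\in k$ such that $Q$ has a $k$-basis $1,i,j,ij$ with $i^2+i=\rho$, $j^2=\sigma$, $ij=j(i+1)$, and $\mathcal{C}$ is isomorphic as a $k$-algebra to $k[X,Y]/(Y^2+XY+\rho X^2+\sigma)$. -/

import Mathlib

open scoped Matrix

universe u v w

noncomputable section

namespace DrinfeldModular

/-- `K` is an algebraic function field of one variable with (full) constant field `k`: there is
`x ∈ K` transcendental over `k` with `[K : k(x)]` finite, and every element of `K` which is
algebraic over `k` lies in `k`. -/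
structure IsFunctionFieldWithConstants (k : Type u) (K : Type w) [Field k] [Field K]
    [Algebra k K] : Prop where
  exists_transcendental : ∃ x : K, Transcendental k x ∧
    FiniteDimensional (IntermediateField.adjoin k {x}) K
  constants : ∀ z : K, IsAlgebraic k z → z ∈ Set.range (algebraMap k K)

/-- A place of `K / k`, given by its valuation ring: a discrete valuation ring `𝒪` with
`k ⊆ 𝒪 ⊊ K` and with field of fractions `K`. (In a function field of one variable every valuation
ring `𝒪` with `k ⊆ 𝒪 ⊊ K` is discrete. A discrete valuation ring is not a field,
so `𝒪 ≠ K`.) -/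
@[ext]
structure Place (k : Type u) (K : Type w) [Field k] [Field K] [Algebra k K] where
  ring : ValuationSubring K
  algebraMap_mem : ∀ a : k, algebraMap k K a ∈ ring
  isDVR : IsDiscreteValuationRing ring

attribute [instance] Place.isDVR

variable {k : Type u} {K : Type w} [Field k] [Field K] [Algebra k K]

namespace Place

/-- The valuation ring of a place is a `k`-algebra. -/
instance (P : Place k K) : Algebra k P.ring :=
  ((algebraMap k K).codRestrict P.ring P.algebraMap_mem).toAlgebra

/-- The degree of a place: the dimension over `k` of its residue field. -/
def degree (P : Place k K) : ℕ :=
  Module.finrank k (IsLocalRing.ResidueField P.ring)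

/-- The place as the maximal ideal of its valuation ring. -/
abbrev ideal (P : Place k K) : IsDedekindDomain.HeightOneSpectrum P.ring :=
  IsDiscreteValuationRing.maximalIdeal P.ring

/-- The normalised discrete valuation of a place, written multiplicatively: a nonzero `x` with
`ν_P(x) = n` is sent to `exp (-n)`, and `0` is sent to `0`. -/
abbrev val (P : Place k K) : Valuation K (WithZero (Multiplicative ℤ)) :=
  P.ideal.valuation K

lemma val_algebraMap_le_one (P : Place k K) (a : k) : P.val (algebraMap k K a) ≤ 1 :=
  P.ideal.valuation_le_one (K := K) (⟨algebraMap k K a, P.algebraMap_mem a⟩ : P.ring)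

end Place

/-- Divisors of `K / k`: the free abelian group on the places. -/
abbrev Divisor (k : Type u) (K : Type w) [Field k] [Field K] [Algebra k K] : Type w :=
  Place k K →₀ ℤ

/-- The degree of a divisor, `∑ A(P) deg P`. -/
def Divisor.deg (A : Divisor k K) : ℤ :=
  A.sum fun P n => n * (P.degree : ℤ)

/-- The Riemann–Roch space `L(A) = {x : x = 0 or ν_P(x) ≥ -A(P) for all places P}`. -/
def riemannRochSpace (A : Divisor k K) : Submodule k K where
  carrier := {x | ∀ P : Place k K, P.val x ≤ WithZero.exp (A P)}
  add_mem' {x y} hx hy P := (P.val.map_add x y).trans (max_le (hx P) (hy P))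
  zero_mem' P := by simp
  smul_mem' a x hx P := by
    rw [Algebra.smul_def, map_mul]
    exact (mul_le_of_le_one_left' (P.val_algebraMap_le_one a)).trans (hx P)

/-- `K / k` has genus `g`: the largest value of `deg A - dim_k L(A) + 1`, as `A` runs through all
divisors, is `g`. -/
def HasGenus (k : Type u) (K : Type w) [Field k] [Field K] [Algebra k K] (g : ℤ) : Prop :=
  IsGreatest (Set.range fun A : Divisor k K =>
    Divisor.deg A - (Module.finrank k (riemannRochSpace A) : ℤ) + 1) g

/-- The ring `𝒞` of all elements of `K` which are integral at every place other than `∞`. -/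
def integersAway (infty : Place k K) : Subalgebra k K where
  carrier := {z | ∀ P : Place k K, P ≠ infty → z ∈ P.ring}
  mul_mem' hx hy P hP := mul_mem (hx P hP) (hy P hP)
  add_mem' hx hy P hP := add_mem (hx P hP) (hy P hP)
  algebraMap_mem' a P _ := P.algebraMap_mem a

/-- The completion `K_∞` of `K` at the place `∞`. -/
abbrev Completion (infty : Place k K) : Type w :=
  infty.ideal.adicCompletion K

/-- The valuation ring `𝒪_∞` of `K_∞`. -/
abbrev CompletionIntegers (infty : Place k K) : ValuationSubring (Completion infty) :=
  infty.ideal.adicCompletionIntegers K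

/-- The subgroup `Z_∞ GL₂(𝒪_∞)` of `GL₂(K_∞)` generated by the scalar matrices and
by `GL₂(𝒪_∞)`. -/
def vertexSubgroup (infty : Place k K) : Subgroup (GL (Fin 2) (Completion infty)) :=
  (Matrix.GeneralLinearGroup.scalar (Fin 2) (R := Completion infty)).range ⊔
    (Matrix.GeneralLinearGroup.map (n := Fin 2) (CompletionIntegers infty).subtype).range

/-- The vertices of the Bruhat–Tits tree of `GL₂(K_∞)`: the left cosets of `Z_∞ GL₂(𝒪_∞)`.
The group `GL₂(K_∞)` acts on them by left multiplication. -/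
abbrev TreeVertex (infty : Place k K) : Type w :=
  GL (Fin 2) (Completion infty) ⧸ vertexSubgroup infty

/-- The inclusion of `GL₂(𝒞)` in `GL₂(K_∞)`. -/
def toGLCompletion (infty : Place k K) :
    GL (Fin 2) (integersAway infty) →* GL (Fin 2) (Completion infty) :=
  Matrix.GeneralLinearGroup.map
    ((algebraMap K (Completion infty)).comp (integersAway infty).val.toRingHom)

/-- The stabilizer `G_v` in `G = GL₂(𝒞)` of a vertex `v`, where `G` acts by left
multiplication through `GL₂(K_∞)`. -/
def vertexStabilizer (infty : Place k K) (v : TreeVertex infty) :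
    Subgroup (GL (Fin 2) (integersAway infty)) :=
  (MulAction.stabilizer (GL (Fin 2) (Completion infty)) v).comap (toGLCompletion infty)

/-- The coordinate ring `k[X, Y] / (Y² + ε X Y + ρ X² + σ)` of an affine conic. -/
abbrev ConicRing (k : Type u) [Field k] (ε ρ σ : k) : Type u :=
  MvPolynomial (Fin 2) k ⧸ Ideal.span
    {(MvPolynomial.X 1 ^ 2 + MvPolynomial.C ε * MvPolynomial.X 0 * MvPolynomial.X 1
      + MvPolynomial.C ρ * MvPolynomial.X 0 ^ 2 + MvPolynomial.C σ : MvPolynomial (Fin 2) k)}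

end DrinfeldModular

end

/-!
A non-split quaternion algebra `Q` of dimension four is a division algebra. It is given by
parameters `ε, ρ, σ` such that `Q` has a basis `1, i, j, i j` with `i² = -ρ - ε i`, `j² = -σ` and
`j i = (-ε - i) j`, where `ε = 0` in characteristic different from two and `ε = -1 = 1` in
characteristic two (`exists_quaternionAlgebra_equiv`). The reduced norm of `y - x i + z j` is the
ternary form `y² + ε x y + ρ x² + σ z²`, which is therefore anisotropic
(`isAnisotropic_of_division`). The function field `K` is that of the conic defined by this form,
and `∞` is the intersection of the conic with the line `z = 0`.

The affine coordinate ring `C = k[X] + k[X] Y` is a domain, since its norm form is anisotropic over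
`k[X]`, and the degree of the norm of an element of `C` is twice its pole order at infinity. The
latter is the maximum of the degrees of `p` and `X q` for an element `p + q Y`
(`CoordRing.natDegree_norm`). Hence the pole order is a valuation. The ring `C` is integrally
closed, since the discriminant `(ε² - 4 ρ) X² - 4 σ` is squarefree if the characteristic is not two,
and by a direct argument otherwise (`CoordRing.isDedekindDomain`). The places of `K` are therefore
`∞` and the primes of `C` (`CoordRing.exists_eq_primePlace`), and `C` is the ring of functions that
are integral away from `∞`. The residue field at `∞` is generated by `Y / X`, which makes
`∞` of degree two. The functions in `C` of pole order at most `n` form a space of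
dimension `2 n + 1`, from which `dim L(A) ≥ deg A + 1` follows for all divisors `A` by comparison
with ideal quotients of `C` (`CoordRing.deg_sub_finrank_add_one_le`). An isomorphism of `K` with
`k(t)` would give a point of the conic over `k(t)`, and an anisotropic form stays anisotropic over
`k[t]`.

Over `C`, the quaternion algebra acts by left multiplication on the left ideal generated by the
element `N = Y + ε X + X i + j` of reduced norm zero. This ideal is free with the basis `N, i N`,
and so `Q` maps to `M₂(C)` (`CoordRing.toMatrix`). Since `j N = (Y - X i) N`, the action of `Q` with
respect to `N, j N` has coefficients which are integral at infinity (`CoordRing.toInftyMatrix`).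
So the units of `Q` fix the vertex `v` given by the lattice spanned by `N` and `j N`. Conversely,
an element of `GL₂(C)` has a determinant of value one at infinity, so that it fixes `v` only if it
preserves the lattice itself (`map_mem_vertexSubgroup_iff`). Its entries then have bounded pole
orders, which leaves only the image of `Q` (`CoordRing.exists_toMatrix_eq`).
-/

noncomputable section

namespace DrinfeldModular

open Polynomial IsDedekindDomain Quaternion

/-! ### Quaternion algebras and the associated ternary form -/

section QuaternionStructure

variable {k : Type u} [Field k] {Q : Type v} [Ring Q] [Algebra k Q]

/-- By Wedderburn's theorem a non-split quaternion algebra is a division algebra. -/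
theorem isUnit_of_nonsplit [Algebra.IsCentral k Q] [IsSimpleRing Q]
    (hdim : Module.finrank k Q = 4)
    (hnonsplit : IsEmpty (Q ≃ₐ[k] Matrix (Fin 2) (Fin 2) k)) (a : Q) (ha : a ≠ 0) :
    IsUnit a := by
  have hfin : Module.Finite k Q := Module.finite_of_finrank_pos (by omega)
  have hart : IsArtinianRing Q := IsArtinianRing.of_finite k Q
  obtain ⟨n, hn, D, hD, hkD, hDfin, ⟨e⟩⟩ :=
    IsSimpleRing.exists_algEquiv_matrix_divisionRing_finite k Q
  have hcard : n * n * Module.finrank k D = 4 := by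
    rw [← hdim, e.toLinearEquiv.finrank_eq, Module.finrank_matrix]
    simp
  have hD0 : 0 < Module.finrank k D := Module.finrank_pos
  have hn0 : 0 < n := Nat.pos_of_ne_zero hn.out
  have hn2 : n ≤ 2 := by
    by_contra! h
    nlinarith [Nat.mul_le_mul h h]
  obtain rfl | rfl : n = 1 ∨ n = 2 := by omega
  · let f : Q ≃+* D := e.toRingEquiv.trans Matrix.uniqueRingEquiv
    have hf : f a ≠ 0 := by simpa using ha
    exact (MulEquiv.isUnit_map f).1 (isUnit_iff_ne_zero.2 hf)
  · exfalso
    have h1 : Module.finrank k D = 1 := by omega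
    have hbij : Function.Bijective (Algebra.ofId k D) :=
      ⟨(algebraMap k D).injective,
        fun d => by
          obtain ⟨c, hc⟩ := (finrank_eq_one_iff_of_nonzero' (1 : D) one_ne_zero).1 h1 d
          exact ⟨c, by rw [Algebra.ofId_apply, Algebra.algebraMap_eq_smul_one, hc]⟩⟩
    exact hnonsplit.false (e.trans (AlgEquiv.ofBijective (Algebra.ofId k D) hbij).symm.mapMatrix)

theorem mem_range_algebraMap_of_forall_commute [Algebra.IsCentral k Q] {a : Q}
    (h : ∀ b : Q, a * b = b * a) : ∃ c : k, algebraMap k Q c = a := by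
  have : a ∈ Subalgebra.center k Q :=
    Subalgebra.mem_center_iff.2 fun b => (h b).symm
  rw [Algebra.IsCentral.center_eq_bot] at this
  exact Algebra.mem_bot.1 this

/-- Every noncentral element `a` of a four-dimensional central division algebra is quadratic: if `Z`
is the centralizer of `a` and `b` does not commute with `a`, then `Z` and `b Z` are independent, so
that `Z` has dimension at most two and `1, a, a²` are dependent. -/
theorem exists_sq_eq_of_division [Algebra.IsCentral k Q]
    (hdim : Module.finrank k Q = 4) (hu : ∀ a : Q, a ≠ 0 → IsUnit a) {a : Q}
    (ha : a ∉ Set.range (algebraMap k Q)) :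
    ∃ s t : k, a * a = algebraMap k Q t + algebraMap k Q s * a := by
  have hfin : Module.Finite k Q := Module.finite_of_finrank_pos (by omega)
  obtain ⟨b, hb⟩ : ∃ b : Q, a * b ≠ b * a := by
    by_contra! h
    exact ha (mem_range_algebraMap_of_forall_commute h)
  set Z := Subalgebra.centralizer k {a} with hZ
  have memZ : ∀ z, z ∈ Z ↔ a * z = z * a := fun z => by
    simp [hZ, Subalgebra.mem_centralizer_iff]
  let φ : (Z × Z) →ₗ[k] Q :=
    Z.val.toLinearMap.coprod ((LinearMap.mulLeft k b).comp Z.val.toLinearMap)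
  have hφ : Function.Injective φ := by
    rw [← LinearMap.ker_eq_bot, LinearMap.ker_eq_bot']
    rintro ⟨⟨z, hz⟩, ⟨z', hz'⟩⟩ h
    have h : z + b * z' = 0 := by simpa [φ] using h
    rw [memZ] at hz hz'
    by_cases h0 : z' = 0
    · subst h0
      have : z = 0 := by simpa using h
      subst this
      rfl
    · exfalso
      apply hb
      have h1 : b * z' = -z := by rw [eq_neg_iff_add_eq_zero, add_comm]; exact h
      apply (hu z' h0).mul_left_injective
      change a * b * z' = b * a * z'
      rw [mul_assoc, h1, mul_assoc, hz', ← mul_assoc, h1, mul_neg, hz, neg_mul]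
  have hle := LinearMap.finrank_le_finrank_of_injective hφ
  rw [Module.finrank_prod, hdim] at hle
  let a' : Z := ⟨a, (memZ a).2 rfl⟩
  have hdep : ¬ LinearIndependent k ![1, a', a' * a'] := by
    intro h
    have := h.fintype_card_le_finrank
    simp at this
    omega
  rw [Fintype.not_linearIndependent_iff] at hdep
  obtain ⟨g, hg, i, hi⟩ := hdep
  rw [Fin.sum_univ_three] at hg
  have hg : algebraMap k Q (g 0) + algebraMap k Q (g 1) * a
      + algebraMap k Q (g 2) * (a * a) = 0 := by
    simpa [a', Algebra.smul_def] using congrArg Z.val hg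
  have hinv : ∀ c : k, c ≠ 0 → algebraMap k Q c⁻¹ * algebraMap k Q c = 1 := fun c hc => by
    rw [← map_mul, inv_mul_cancel₀ hc, map_one]
  by_cases h2 : g 2 = 0
  · exfalso
    rw [h2, map_zero, zero_mul, add_zero] at hg
    by_cases h1 : g 1 = 0
    · have : Nontrivial Q := ⟨⟨a, b, fun h => hb (by rw [h])⟩⟩
      have h0 : g 0 = 0 := by simpa [h1] using hg
      fin_cases i <;> simp_all
    · apply ha
      refine ⟨(g 1)⁻¹ * -g 0, ?_⟩
      have h3 : algebraMap k Q (g 1) * a = algebraMap k Q (-g 0) := by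
        rw [map_neg, eq_neg_iff_add_eq_zero, add_comm]; exact hg
      rw [map_mul, ← h3, ← mul_assoc, hinv _ h1, one_mul]
  · refine ⟨(g 2)⁻¹ * -g 1, (g 2)⁻¹ * -g 0, ?_⟩
    have h3 : algebraMap k Q (g 2) * (a * a) =
        algebraMap k Q (-g 0) + algebraMap k Q (-g 1) * a := by
      rw [map_neg, map_neg, neg_mul, ← sub_eq_zero, ← hg]; abel
    rw [map_mul, map_mul, mul_assoc _ _ a, ← mul_add, ← h3, ← mul_assoc, hinv _ h2, one_mul]

/-- An element `i` of a four-dimensional division algebra with `i² = α + β i` which is not equal to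
its conjugate `β - i` is part of a standard quaternion basis: for `b` not commuting with `i`, the
commutator `j = b i - i b` satisfies `j i = (β - i) j`, and `j²` is a scalar. -/
theorem exists_quaternionAlgebra_equiv [Algebra.IsCentral k Q]
    (hdim : Module.finrank k Q = 4) (hu : ∀ a : Q, a ≠ 0 → IsUnit a) {i : Q} {α β : k}
    (hi : i ∉ Set.range (algebraMap k Q))
    (hii : i * i = algebraMap k Q α + algebraMap k Q β * i)
    (hsep : i ≠ algebraMap k Q β - i) :
    ∃ γ : k, Nonempty (Q ≃ₐ[k] QuaternionAlgebra k α β γ) := by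
  have hfin : Module.Finite k Q := Module.finite_of_finrank_pos (by omega)
  obtain ⟨b, hb⟩ : ∃ b : Q, b * i ≠ i * b := by
    by_contra! h
    exact hi (mem_range_algebraMap_of_forall_commute fun b => (h b).symm)
  have hcomm : ∀ (c : k) (a : Q), algebraMap k Q c * a = a * algebraMap k Q c :=
    fun c a => Algebra.commutes c a
  obtain ⟨j, hj⟩ : ∃ j, j = b * i - i * b := ⟨_, rfl⟩
  have hj0 : j ≠ 0 := by rw [hj]; exact sub_ne_zero.2 hb
  have hji : j * i = (algebraMap k Q β - i) * j := by
    have h1 : b * i * i = b * algebraMap k Q α + b * algebraMap k Q β * i := by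
      rw [mul_assoc, hii]; noncomm_ring
    have h2 : i * (i * b) = algebraMap k Q α * b + algebraMap k Q β * (i * b) := by
      rw [← mul_assoc, hii]; noncomm_ring
    rw [hj, sub_mul, h1, mul_sub, sub_mul, sub_mul, h2, hcomm α b, ← hcomm β b]
    noncomm_ring
  have hne : j * i ≠ i * j := fun h => by
    apply hsep
    apply (hu j hj0).mul_left_injective
    change i * j = _ * j
    rw [← h, hji]
  have hjr : j ∉ Set.range (algebraMap k Q) := by
    rintro ⟨c, rfl⟩
    exact hne (hcomm c i)
  obtain ⟨s, t, hst⟩ := exists_sq_eq_of_division hdim hu hjr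
  have hjji : j * j * i = i * (j * j) := by
    rw [mul_assoc, hji, ← mul_assoc, mul_sub, ← hcomm β, hji]
    noncomm_ring
  have hs : s = 0 := by
    by_contra hs
    apply hne
    rw [hst, add_mul, mul_add, hcomm t i, add_right_inj, mul_assoc, ← mul_assoc i, ← hcomm s i,
      mul_assoc] at hjji
    have : IsUnit (algebraMap k Q s) := (isUnit_iff_ne_zero.2 hs).map _
    exact this.mul_right_injective hjji
  rw [hs, map_zero, zero_mul, add_zero] at hst
  let B : QuaternionAlgebra.Basis Q α β t :=
    { i := i
      j := j
      k := i * j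
      i_mul_i := by rw [hii]; simp [Algebra.smul_def]
      j_mul_j := by rw [hst, Algebra.algebraMap_eq_smul_one]
      i_mul_j := rfl
      j_mul_i := by rw [hji, sub_mul, Algebra.smul_def] }
  refine ⟨t, ⟨(AlgEquiv.ofBijective B.liftHom ?_).symm⟩⟩
  have hkey : ∀ c d : k, algebraMap k Q c + algebraMap k Q d * i = 0 → c = 0 ∧ d = 0 := by
    intro c d h
    have : Nontrivial Q := ⟨⟨j, 0, hj0⟩⟩
    by_cases hd : d = 0
    · subst hd
      simpa using h
    · exfalso
      apply hi
      refine ⟨d⁻¹ * -c, ?_⟩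
      have h3 : algebraMap k Q d * i = algebraMap k Q (-c) := by
        rw [map_neg, eq_neg_iff_add_eq_zero, add_comm]; exact h
      rw [map_mul, ← h3, ← mul_assoc, ← map_mul, inv_mul_cancel₀ hd, map_one, one_mul]
  have hinj : Function.Injective B.liftHom := by
    rw [injective_iff_map_eq_zero]
    rintro ⟨c₁, c₂, c₃, c₄⟩ h
    have h : algebraMap k Q c₁ + algebraMap k Q c₂ * i
        + (algebraMap k Q c₃ + algebraMap k Q c₄ * i) * j = 0 := by
      rw [← h]
      simp [B, QuaternionAlgebra.Basis.lift, Algebra.smul_def, add_mul, mul_assoc, add_assoc]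
    have hz : algebraMap k Q c₃ + algebraMap k Q c₄ * i = 0 := by
      by_contra h0
      apply hne
      have hcomm_i : ∀ c d : k, (algebraMap k Q c + algebraMap k Q d * i) * i =
          i * (algebraMap k Q c + algebraMap k Q d * i) := fun c d => by
        rw [add_mul, mul_add, hcomm c i, ← mul_assoc i, ← hcomm d i]
      set z := algebraMap k Q c₃ + algebraMap k Q c₄ * i with hz
      set y := algebraMap k Q c₁ + algebraMap k Q c₂ * i with hy
      have hzj : z * j = -y := by rw [eq_neg_iff_add_eq_zero, add_comm]; exact h
      apply (hu z h0).mul_right_injective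
      change z * (j * i) = z * (i * j)
      rw [← mul_assoc, hzj, ← mul_assoc, hz, hcomm_i, ← hz, mul_assoc, hzj, neg_mul, hy, hcomm_i,
        mul_neg]
    rw [hz, zero_mul, add_zero] at h
    obtain ⟨rfl, rfl⟩ := hkey _ _ h
    obtain ⟨rfl, rfl⟩ := hkey _ _ hz
    rfl
  refine ⟨hinj, ?_⟩
  have h4 : Module.finrank k (QuaternionAlgebra k α β t) = Module.finrank k Q := by
    rw [hdim, QuaternionAlgebra.finrank_eq_four]
  exact (LinearMap.injective_iff_surjective_of_finrank_eq_finrank h4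
    (f := B.liftHom.toLinearMap)).1 hinj

/-- In characteristic different from two, completing the square gives a noncentral element whose
square is a scalar. -/
theorem exists_quaternionAlgebra_equiv_of_two_ne_zero [Algebra.IsCentral k Q]
    (hdim : Module.finrank k Q = 4) (hu : ∀ a : Q, a ≠ 0 → IsUnit a) (h2 : (2 : k) ≠ 0) :
    ∃ α γ : k, Nonempty (Q ≃ₐ[k] QuaternionAlgebra k α 0 γ) := by
  obtain ⟨a, ha⟩ : ∃ a : Q, a ∉ Set.range (algebraMap k Q) := by
    by_contra! h
    have : Module.finrank k Q ≤ 1 := by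
      refine finrank_le_one (1 : Q) fun w => ?_
      obtain ⟨c, rfl⟩ := h w
      exact ⟨c, (Algebra.algebraMap_eq_smul_one c).symm⟩
    omega
  obtain ⟨s, t, hst⟩ := exists_sq_eq_of_division hdim hu ha
  have hcomm : ∀ (c : k) (a : Q), algebraMap k Q c * a = a * algebraMap k Q c :=
    fun c a => Algebra.commutes c a
  obtain ⟨i, hi⟩ : ∃ i, i = a - algebraMap k Q (s / 2) := ⟨_, rfl⟩
  have hir : i ∉ Set.range (algebraMap k Q) := by
    rintro ⟨c, hc⟩
    exact ha ⟨c + s / 2, by rw [map_add, hc, hi, sub_add_cancel]⟩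
  have hs : algebraMap k Q s = algebraMap k Q (s / 2) + algebraMap k Q (s / 2) := by
    rw [← map_add]; congr 1; field_simp; norm_num
  have hii : i * i = algebraMap k Q (t + s / 2 * (s / 2)) + algebraMap k Q 0 * i := by
    rw [hi, map_zero, zero_mul, add_zero, sub_mul, mul_sub, mul_sub, hst, hs, map_add, map_mul,
      ← hcomm]
    noncomm_ring
  have hsep : i ≠ algebraMap k Q 0 - i := by
    intro h
    have h3 : algebraMap k Q 2 * i = 0 := by
      rw [map_ofNat, two_mul]; nth_rw 1 [h]; simp
    have hi0 : i = 0 := by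
      have : IsUnit (algebraMap k Q 2) := (isUnit_iff_ne_zero.2 h2).map _
      exact (this.mul_right_eq_zero).1 h3
    exact hir ⟨0, by rw [hi0, map_zero]⟩
  obtain ⟨γ, h⟩ := exists_quaternionAlgebra_equiv hdim hu hir hii hsep
  exact ⟨_, γ, h⟩

/-- In characteristic two a separable quadratic element exists: if all squares were scalars, then so
would be all `a b + b a`; replacing `b` by `a b` shows `(a b + b a) a` to be a scalar, and
then `a` would be one as soon as it does not commute with `b`. -/
theorem exists_quaternionAlgebra_equiv_of_two_eq_zero [Algebra.IsCentral k Q]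
    (hdim : Module.finrank k Q = 4) (hu : ∀ a : Q, a ≠ 0 → IsUnit a) (h2 : (2 : k) = 0) :
    ∃ α γ : k, Nonempty (Q ≃ₐ[k] QuaternionAlgebra k α 1 γ) := by
  have hcomm : ∀ (c : k) (a : Q), algebraMap k Q c * a = a * algebraMap k Q c :=
    fun c a => Algebra.commutes c a
  have hadd : ∀ a : Q, a + a = 0 := fun a => by
    rw [← two_mul, ← map_ofNat (algebraMap k Q) 2, h2, map_zero, zero_mul]
  have hQ : Nontrivial Q := by
    refine Module.nontrivial_of_finrank_pos (R := k) ?_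
    omega
  obtain ⟨a, s, t, ha, hs, hst⟩ : ∃ (a : Q) (s t : k), a ∉ Set.range (algebraMap k Q) ∧ s ≠ 0 ∧
      a * a = algebraMap k Q t + algebraMap k Q s * a := by
    by_contra! H
    have hsq : ∀ a : Q, ∃ t : k, algebraMap k Q t = a * a := by
      intro a
      by_cases ha : a ∈ Set.range (algebraMap k Q)
      · obtain ⟨c, rfl⟩ := ha
        exact ⟨c * c, map_mul _ _ _⟩
      · obtain ⟨s, t, hst⟩ := exists_sq_eq_of_division hdim hu ha
        have hs : s = 0 := by
          by_contra hs
          exact H a s t ha hs hst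
        exact ⟨t, by rw [hst, hs, map_zero, zero_mul, add_zero]⟩
    have hab : ∀ a b : Q, ∃ t : k, algebraMap k Q t = a * b + b * a := by
      intro a b
      obtain ⟨t₁, h₁⟩ := hsq (a + b)
      obtain ⟨t₂, h₂⟩ := hsq a
      obtain ⟨t₃, h₃⟩ := hsq b
      refine ⟨t₁ - t₂ - t₃, ?_⟩
      rw [map_sub, map_sub, h₁, h₂, h₃]
      noncomm_ring
    have hall : ∀ a b : Q, a * b = b * a := by
      intro a b
      by_contra hne
      obtain ⟨c, hc⟩ := hab a b
      obtain ⟨d, hd⟩ := hab a (a * b)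
      have hc0 : c ≠ 0 := by
        rintro rfl
        apply hne
        rw [map_zero] at hc
        rw [eq_neg_of_add_eq_zero_left hc.symm]
        exact neg_eq_of_add_eq_zero_left (hadd _)
      have hda : algebraMap k Q d = algebraMap k Q c * a := by
        rw [hd, hcomm, hc]; noncomm_ring
      apply hne
      have : a = algebraMap k Q (c⁻¹ * d) := by
        rw [map_mul, hda, ← mul_assoc, ← map_mul, inv_mul_cancel₀ hc0, map_one, one_mul]
      rw [this]
      exact hcomm _ _
    have : Module.finrank k Q ≤ 1 := by
      refine finrank_le_one (1 : Q) fun w => ?_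
      obtain ⟨c, rfl⟩ := mem_range_algebraMap_of_forall_commute (k := k) (hall w)
      exact ⟨c, (Algebra.algebraMap_eq_smul_one c).symm⟩
    omega
  obtain ⟨i, hi⟩ : ∃ i, i = algebraMap k Q s⁻¹ * a := ⟨_, rfl⟩
  have hai : a = algebraMap k Q s * i := by
    rw [hi, ← mul_assoc, ← map_mul, mul_inv_cancel₀ hs, map_one, one_mul]
  have hir : i ∉ Set.range (algebraMap k Q) := by
    rintro ⟨c, hc⟩
    exact ha ⟨s * c, by rw [map_mul, hc, ← hai]⟩
  have hii : i * i = algebraMap k Q (s⁻¹ * s⁻¹ * t) + algebraMap k Q 1 * i := by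
    have h1 : i * i = algebraMap k Q (s⁻¹ * s⁻¹) * (a * a) := by
      rw [hi, map_mul, mul_assoc, ← mul_assoc a, ← hcomm _ a]; noncomm_ring
    rw [h1, hst, mul_add, ← map_mul, ← mul_assoc, ← map_mul, hai, ← mul_assoc, ← map_mul]
    congr 3
    field_simp
  have hsep : i ≠ algebraMap k Q 1 - i := by
    intro h
    have h3 := hadd i
    nth_rw 1 [h] at h3
    rw [sub_add_cancel, map_one] at h3
    exact one_ne_zero h3
  obtain ⟨γ, h⟩ := exists_quaternionAlgebra_equiv hdim hu hir hii hsep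
  exact ⟨_, γ, h⟩

end QuaternionStructure

/-- The ternary quadratic form `Y² + ε X Y + ρ X² + σ Z²` has no nontrivial zero over `R`. -/
def IsAnisotropic {R : Type u} [CommRing R] (ε ρ σ : R) : Prop :=
  ∀ y x z : R, y ^ 2 + ε * x * y + ρ * x ^ 2 + σ * z ^ 2 = 0 → y = 0 ∧ x = 0 ∧ z = 0

/-- The form is the reduced norm on the span of `1, i, j`, at `y - x i + z j`. -/
theorem isAnisotropic_of_division {k : Type u} [Field k] {ε ρ σ : k}
    (hu : ∀ a : QuaternionAlgebra k (-ρ) (-ε) (-σ), a ≠ 0 → IsUnit a) : IsAnisotropic ε ρ σ := by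
  intro y x z h
  let u : QuaternionAlgebra k (-ρ) (-ε) (-σ) := ⟨y, -x, z, 0⟩
  -- `u'` is the conjugate of `u`.
  let u' : QuaternionAlgebra k (-ρ) (-ε) (-σ) := ⟨y + ε * x, x, -z, 0⟩
  have huu : u * u' = 0 := by
    ext
    · simp [u, u']; linear_combination h
    · simp [u, u']; ring
    · simp [u, u']; ring
    · simp [u, u']; ring
  by_cases hu0 : u = 0
  · have h1 := congrArg QuaternionAlgebra.re hu0
    have h2 := congrArg QuaternionAlgebra.imI hu0
    have h3 := congrArg QuaternionAlgebra.imJ hu0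
    exact ⟨by simpa [u] using h1, by simpa [u] using h2, by simpa [u] using h3⟩
  · have hu0' : u' = 0 := ((hu u hu0).mul_right_eq_zero).1 huu
    have h1 := congrArg QuaternionAlgebra.re hu0'
    have h2 := congrArg QuaternionAlgebra.imI hu0'
    have h3 := congrArg QuaternionAlgebra.imJ hu0'
    have hx : x = 0 := by simpa [u'] using h2
    exact ⟨by simpa [u', hx] using h1, hx, by simpa [u'] using h3⟩

/-! ### The affine coordinate ring of an anisotropic conic -/

section Anisotropic

variable {k : Type u} [Field k] {ε ρ σ : k}

theorem natDegree_form_le {ε ρ σ : k} {n : ℕ} {y x z : k[X]} (hy : y.natDegree ≤ n)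
    (hx : x.natDegree ≤ n) (hz : z.natDegree ≤ n) :
    (y ^ 2 + C ε * x * y + C ρ * x ^ 2 + C σ * z ^ 2).natDegree ≤ n + n := by
  simp only [sq, mul_assoc]
  refine natDegree_add_le_of_degree_le (natDegree_add_le_of_degree_le
    (natDegree_add_le_of_degree_le ?_ ?_) ?_) ?_
  · exact natDegree_mul_le_of_le hy hy
  all_goals refine (natDegree_C_mul_le _ _).trans ?_
  · exact natDegree_mul_le_of_le hx hy
  · exact natDegree_mul_le_of_le hx hx
  · exact natDegree_mul_le_of_le hz hz

theorem coeff_form {ε ρ σ : k} {n : ℕ} {y x z : k[X]} (hy : y.natDegree ≤ n)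
    (hx : x.natDegree ≤ n) (hz : z.natDegree ≤ n) :
    (y ^ 2 + C ε * x * y + C ρ * x ^ 2 + C σ * z ^ 2).coeff (n + n) =
      y.coeff n ^ 2 + ε * x.coeff n * y.coeff n + ρ * x.coeff n ^ 2 + σ * z.coeff n ^ 2 := by
  simp only [sq, mul_assoc, coeff_add, coeff_C_mul, coeff_mul_add_eq_of_natDegree_le hy hy,
    coeff_mul_add_eq_of_natDegree_le hx hy, coeff_mul_add_eq_of_natDegree_le hx hx,
    coeff_mul_add_eq_of_natDegree_le hz hz]

/-- The leading coefficients of a zero over `k[X]` would form a zero over `k`. -/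
theorem IsAnisotropic.polynomial (h : IsAnisotropic ε ρ σ) :
    IsAnisotropic (C ε) (C ρ) (C σ) := by
  have key : ∀ (n : ℕ) (y x z : k[X]), y.natDegree ≤ n → x.natDegree ≤ n → z.natDegree ≤ n →
      y ^ 2 + C ε * x * y + C ρ * x ^ 2 + C σ * z ^ 2 = 0 →
      y.coeff n = 0 ∧ x.coeff n = 0 ∧ z.coeff n = 0 := by
    intro n y x z hy hx hz h0
    have := coeff_form (ε := ε) (ρ := ρ) (σ := σ) hy hx hz
    rw [h0, coeff_zero] at this
    exact h _ _ _ this.symm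
  have main : ∀ (n : ℕ) (y x z : k[X]), y.natDegree ≤ n → x.natDegree ≤ n → z.natDegree ≤ n →
      y ^ 2 + C ε * x * y + C ρ * x ^ 2 + C σ * z ^ 2 = 0 → y = 0 ∧ x = 0 ∧ z = 0 := by
    intro n
    induction n with
    | zero =>
      intro y x z hy hx hz h0
      obtain ⟨h1, h2, h3⟩ := key 0 y x z hy hx hz h0
      rw [eq_C_of_natDegree_le_zero hy, eq_C_of_natDegree_le_zero hx,
        eq_C_of_natDegree_le_zero hz, h1, h2, h3]
      simp
    | succ n ih =>
      intro y x z hy hx hz h0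
      obtain ⟨h1, h2, h3⟩ := key (n + 1) y x z hy hx hz h0
      exact ih y x z (natDegree_le_pred hy h1) (natDegree_le_pred hx h2)
        (natDegree_le_pred hz h3) h0
  intro y x z h0
  exact main (max y.natDegree (max x.natDegree z.natDegree)) y x z (by simp) (by simp) (by simp) h0

end Anisotropic

/-- The coordinate ring of the affine conic `Y² + ε X Y + ρ X² + σ = 0`, as a quadratic algebra
over `k[X]`: the element `⟨p, q⟩` is `p + q Y`. -/
abbrev CoordRing (k : Type u) [Field k] (ε ρ σ : k) : Type u :=
  QuadraticAlgebra k[X] (-(C ρ * X ^ 2 + C σ)) (-(C ε * X))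

namespace CoordRing

variable {k : Type u} [Field k] {ε ρ σ : k}

theorem norm_eq_form (z : CoordRing k ε ρ σ) :
    z.norm = z.re ^ 2 + C ε * (-(X * z.im)) * z.re + C ρ * (-(X * z.im)) ^ 2
      + C σ * z.im ^ 2 := by
  rw [QuadraticAlgebra.norm_def]; ring

theorem norm_ne_zero (h : IsAnisotropic ε ρ σ) {z : CoordRing k ε ρ σ} (hz : z ≠ 0) :
    z.norm ≠ 0 := by
  intro h0
  rw [norm_eq_form] at h0
  obtain ⟨h1, -, h3⟩ := h.polynomial _ _ _ h0
  exact hz (QuadraticAlgebra.ext h1 h3)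

theorem isDomain (h : IsAnisotropic ε ρ σ) : IsDomain (CoordRing k ε ρ σ) := by
  have : NoZeroDivisors (CoordRing k ε ρ σ) := ⟨fun {a b} hab => by
    by_contra! H
    have h1 : a.norm * b.norm = 0 := by rw [← map_mul, hab, QuadraticAlgebra.norm_zero]
    exact mul_ne_zero (norm_ne_zero h H.1) (norm_ne_zero h H.2) h1⟩
  exact NoZeroDivisors.to_isDomain _

/-- The pole order at infinity of a function `p + q Y` on the affine conic, where `X` and `Y` have
pole order one: the maximum of `deg p` and `deg (X q)`. -/
def poleOrder (z : CoordRing k ε ρ σ) : ℕ := max z.re.natDegree (X * z.im).natDegree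

theorem poleOrder_le_iff {z : CoordRing k ε ρ σ} {n : ℕ} :
    z.poleOrder ≤ n ↔ z.re.natDegree ≤ n ∧ (X * z.im).natDegree ≤ n := max_le_iff

theorem natDegree_im_le {z : CoordRing k ε ρ σ} {n : ℕ} (h : (X * z.im).natDegree ≤ n) :
    z.im.natDegree ≤ n := by
  by_cases h0 : z.im = 0
  · simp [h0]
  · rw [natDegree_X_mul h0] at h; omega

theorem coeff_im_eq_zero {z : CoordRing k ε ρ σ} {n : ℕ} (h : (X * z.im).natDegree ≤ n) :
    z.im.coeff n = 0 := by
  rw [← coeff_X_mul]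
  exact coeff_eq_zero_of_natDegree_lt (by omega)

theorem coeff_norm {z : CoordRing k ε ρ σ} {n : ℕ} (h : z.poleOrder ≤ n) :
    z.norm.coeff (n + n) = z.re.coeff n ^ 2 + ε * (-(X * z.im).coeff n) * z.re.coeff n
      + ρ * (-(X * z.im).coeff n) ^ 2 := by
  obtain ⟨h1, h2⟩ := poleOrder_le_iff.1 h
  rw [norm_eq_form, coeff_form h1 (by rwa [natDegree_neg]) (natDegree_im_le h2),
    coeff_im_eq_zero h2, coeff_neg]
  ring

/-- The coefficient of `norm z` in degree twice the pole order of `z` is a nonzero value of the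
binary form `y² + ε x y + ρ x²`. -/
theorem natDegree_norm (h : IsAnisotropic ε ρ σ) (z : CoordRing k ε ρ σ) :
    z.norm.natDegree = z.poleOrder + z.poleOrder := by
  by_cases hz : z = 0
  · simp [hz, poleOrder]
  refine natDegree_eq_of_le_of_coeff_ne_zero ?_ ?_
  · obtain ⟨h1, h2⟩ := poleOrder_le_iff.1 (le_refl z.poleOrder)
    rw [norm_eq_form]
    exact natDegree_form_le h1 (by rwa [natDegree_neg]) (natDegree_im_le h2)
  · rw [coeff_norm le_rfl]
    intro h0
    obtain ⟨h1, h2, -⟩ := h (z.re.coeff z.poleOrder) (-(X * z.im).coeff z.poleOrder) 0 (by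
      linear_combination h0)
    rw [neg_eq_zero] at h2
    have h3 : z.re = 0 ∨ z.re.natDegree < z.poleOrder := by
      by_contra! H
      have : z.re.natDegree = z.poleOrder := le_antisymm (le_max_left _ _) H.2
      rw [← this, coeff_natDegree, leadingCoeff_eq_zero] at h1
      exact H.1 h1
    have h4 : X * z.im = 0 ∨ (X * z.im).natDegree < z.poleOrder := by
      by_contra! H
      have : (X * z.im).natDegree = z.poleOrder := le_antisymm (le_max_right _ _) H.2
      rw [← this, coeff_natDegree, leadingCoeff_eq_zero] at h2
      exact H.1 h2
    have h5 : z.poleOrder = max z.re.natDegree (X * z.im).natDegree := rfl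
    rcases h3 with h3 | h3 <;> rcases h4 with h4 | h4
    · exact hz (QuadraticAlgebra.ext h3 ((mul_eq_zero_iff_left X_ne_zero).1 h4))
    · rw [h3, natDegree_zero] at h5; omega
    · rw [h4, natDegree_zero] at h5; omega
    · omega

theorem poleOrder_mul (h : IsAnisotropic ε ρ σ) {z w : CoordRing k ε ρ σ} (hz : z ≠ 0)
    (hw : w ≠ 0) : (z * w).poleOrder = z.poleOrder + w.poleOrder := by
  have h1 := natDegree_norm h (z * w)
  rw [map_mul, natDegree_mul (norm_ne_zero h hz) (norm_ne_zero h hw), natDegree_norm h,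
    natDegree_norm h] at h1
  omega

theorem poleOrder_add_le (z w : CoordRing k ε ρ σ) :
    (z + w).poleOrder ≤ max z.poleOrder w.poleOrder := by
  rw [poleOrder_le_iff, QuadraticAlgebra.re_add, QuadraticAlgebra.im_add, mul_add]
  constructor
  · exact (natDegree_add_le _ _).trans (max_le_max (le_max_left _ _) (le_max_left _ _))
  · exact (natDegree_add_le _ _).trans (max_le_max (le_max_right _ _) (le_max_right _ _))

open WithZero in
/-- The valuation on the coordinate ring given by the pole order at infinity. -/
def inftyValuation (h : IsAnisotropic ε ρ σ) :
    Valuation (CoordRing k ε ρ σ) (WithZero (Multiplicative ℤ)) where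
  toFun z := open Classical in if z = 0 then 0 else exp (z.poleOrder : ℤ)
  map_zero' := by simp
  map_one' := by
    have := isDomain h
    have h1 : (1 : CoordRing k ε ρ σ).poleOrder = 0 := by
      simp [poleOrder, QuadraticAlgebra.re_one, QuadraticAlgebra.im_one]
    simp [h1]
  map_mul' z w := by
    have := isDomain h
    by_cases hz : z = 0
    · simp [hz]
    by_cases hw : w = 0
    · simp [hw]
    simp [hz, hw, poleOrder_mul h hz hw, exp_add]
  map_add_le_max' z w := by
    by_cases hzw : z + w = 0
    · simp [hzw]
    by_cases hz : z = 0
    · rw [hz, zero_add]; simp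
    by_cases hw : w = 0
    · rw [hw, add_zero]; simp
    have := poleOrder_add_le z w
    rw [if_neg hzw, if_neg hz, if_neg hw, le_max_iff, exp_le_exp, exp_le_exp]
    rw [le_max_iff] at this
    exact_mod_cast this

theorem inftyValuation_of_ne_zero (h : IsAnisotropic ε ρ σ) {z : CoordRing k ε ρ σ} (hz : z ≠ 0) :
    inftyValuation h z = WithZero.exp (z.poleOrder : ℤ) := if_neg hz

theorem inftyValuation_le_exp_iff (h : IsAnisotropic ε ρ σ) {z : CoordRing k ε ρ σ} {n : ℕ} :
    inftyValuation h z ≤ WithZero.exp (n : ℤ) ↔ z.poleOrder ≤ n := by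
  by_cases hz : z = 0
  · simp [hz, poleOrder]
  · rw [inftyValuation_of_ne_zero h hz, WithZero.exp_le_exp, Nat.cast_le]

theorem inftyValuation_eq_zero_iff (h : IsAnisotropic ε ρ σ) {z : CoordRing k ε ρ σ} :
    inftyValuation h z = 0 ↔ z = 0 := by
  constructor
  · intro h0
    by_contra hz
    rw [inftyValuation_of_ne_zero h hz] at h0
    exact WithZero.exp_ne_zero h0
  · rintro rfl; exact map_zero _

theorem poleOrder_algebraMap (f : k[X]) :
    (algebraMap k[X] (CoordRing k ε ρ σ) f).poleOrder = f.natDegree := by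
  simp [poleOrder]

theorem inftyValuation_eq_one_of_isUnit (h : IsAnisotropic ε ρ σ) {z : CoordRing k ε ρ σ}
    (hz : IsUnit z) :
    inftyValuation h z = 1 := by
  have := isDomain h
  obtain ⟨w, hw⟩ := hz.exists_right_inv
  have hz0 : z ≠ 0 := hz.ne_zero
  have hw0 : w ≠ 0 := right_ne_zero_of_mul_eq_one hw
  have h1 := poleOrder_mul h hz0 hw0
  have h2 : (1 : CoordRing k ε ρ σ).poleOrder = 0 := by
    simp [poleOrder, QuadraticAlgebra.re_one, QuadraticAlgebra.im_one]
  rw [hw, h2] at h1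
  have h3 : z.poleOrder = 0 := by omega
  rw [inftyValuation_of_ne_zero h hz0, h3]
  simp

section IntegrallyClosed

/-- The local form of integral closedness at a prime `π` of `k[X]`. In characteristic different
from two, it rests on the discriminant `(ε² - 4 ρ) X² - 4 σ` being squarefree; in
characteristic two, the trace `ε X q` can be divisible by `π` only if `π ∣ q` or `π` is associated
to `X`, and at `X = 0` the form is anisotropic. -/
theorem prime_dvd_of_dvd_trace_of_sq_dvd_norm (h : IsAnisotropic ε ρ σ)
    (hdisc : ε ^ 2 - 4 * ρ ≠ 0) {π : k[X]} (hπ : Prime π) {z : CoordRing k ε ρ σ}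
    (htr : π ∣ z.trace) (hnorm : π ^ 2 ∣ z.norm) : π ∣ z.re ∧ π ∣ z.im := by
  have hσ : σ ≠ 0 := by
    rintro rfl
    exact one_ne_zero (h 0 0 1 (by ring)).2.2
  have hπN : π ∣ z.norm := (dvd_pow_self π two_ne_zero).trans hnorm
  rw [norm_eq_form] at hnorm hπN
  rw [QuadraticAlgebra.trace_def] at htr
  have hre : π ∣ z.im → π ∣ z.re := by
    intro him
    refine hπ.dvd_of_dvd_pow (n := 2) ?_
    obtain ⟨t, ht⟩ := him
    obtain ⟨s, hs⟩ := hπN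
    refine ⟨s + C ε * X * t * z.re - C ρ * X ^ 2 * π * t ^ 2 - C σ * π * t ^ 2, ?_⟩
    rw [ht] at hs
    linear_combination hs
  by_cases h2 : (2 : k) = 0
  · have hε : ε ≠ 0 := by
      rintro rfl
      apply hdisc
      linear_combination (-2 * ρ) * h2
    have h2' : (2 : k[X]) = 0 := by
      rw [← map_ofNat (C : k →+* k[X]) 2, h2, map_zero]
    rw [h2', zero_mul, zero_add, neg_mul, dvd_neg] at htr
    rcases hπ.dvd_or_dvd htr with h3 | h3
    · rcases hπ.dvd_or_dvd h3 with h4 | h4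
      · exact absurd (isUnit_of_dvd_unit h4 (isUnit_C.2 (isUnit_iff_ne_zero.2 hε))) hπ.not_isUnit
      · have hX : X ∣ π := (hπ.irreducible.dvd_symm irreducible_X) h4
        obtain ⟨s, hs⟩ := hX.trans hπN
        have h5 := congrArg (eval 0) hs
        simp only [eval_add, eval_mul, eval_pow, eval_neg, eval_C, eval_X] at h5
        obtain ⟨h6, -, h7⟩ := h (z.re.eval 0) 0 (z.im.eval 0) (by linear_combination h5)
        exact ⟨h4.trans (X_dvd_iff.2 (by rwa [coeff_zero_eq_eval_zero])),
          h4.trans (X_dvd_iff.2 (by rwa [coeff_zero_eq_eval_zero]))⟩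
    · exact ⟨hre h3, h3⟩
  · have him : π ∣ z.im := by
      by_contra him
      obtain ⟨D, hD⟩ : ∃ D : k[X], D = C (ε ^ 2 - 4 * ρ) * X ^ 2 - C (4 * σ) := ⟨_, rfl⟩
      have hDq : π ^ 2 ∣ D * z.im ^ 2 := by
        obtain ⟨s, hs⟩ := hnorm
        obtain ⟨t, ht⟩ := htr
        refine ⟨t ^ 2 - 4 * s, ?_⟩
        have hC4 : (C (4 : k) : k[X]) = 4 := map_ofNat C 4
        rw [hD]
        simp only [map_sub, map_mul, map_pow, hC4]
        linear_combination (-4) * hs + (2 * z.re - C ε * X * z.im + π * t) * ht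
      obtain ⟨E, hE⟩ := hπ.pow_dvd_of_dvd_mul_right 2 (fun h3 => him (hπ.dvd_of_dvd_pow h3)) hDq
      have hder : derivative D = 2 * C (ε ^ 2 - 4 * ρ) * X := by
        rw [hD, derivative_sub, derivative_C_mul, derivative_X_pow, derivative_C]
        simp only [Nat.cast_ofNat, Nat.add_one_sub_one, pow_one, map_ofNat]; ring
      have hder' : derivative D = π * (2 * derivative π * E + π * derivative E) := by
        rw [hE, derivative_mul, derivative_pow]
        simp only [Nat.cast_ofNat, Nat.add_one_sub_one, pow_one, map_ofNat]; ring
      have hdvd : π ∣ C (8 * σ) := by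
        refine ⟨X * (2 * derivative π * E + π * derivative E) - 2 * π * E, ?_⟩
        have hC8 : (C (8 : k) : k[X]) = 8 := map_ofNat C 8
        have hC4 : (C (4 : k) : k[X]) = 4 := map_ofNat C 4
        have h3 : π * (X * (2 * derivative π * E + π * derivative E) - 2 * π * E)
            = X * derivative D - 2 * D := by
          rw [hder', hE]; ring
        rw [h3, hder, hD]
        simp only [map_sub, map_mul, map_pow, hC4, hC8]
        ring
      have h8 : (8 * σ : k) ≠ 0 := by
        have : (8 : k) = 2 ^ 3 := by norm_num
        rw [this]
        exact mul_ne_zero (pow_ne_zero _ h2) hσ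
      exact hπ.not_isUnit (isUnit_of_dvd_unit hdvd (isUnit_C.2 (isUnit_iff_ne_zero.2 h8)))
    exact ⟨hre him, him⟩

section

variable {K : Type w} [Field K] [Algebra (CoordRing k ε ρ σ) K]
  [IsFractionRing (CoordRing k ε ρ σ) K] [Algebra k[X] K] [IsScalarTower k[X] (CoordRing k ε ρ σ) K]

theorem algebraMap_polynomial_injective (ε ρ σ : k) (K : Type w) [Field K]
    [Algebra (CoordRing k ε ρ σ) K] [IsFractionRing (CoordRing k ε ρ σ) K] [Algebra k[X] K]
    [IsScalarTower k[X] (CoordRing k ε ρ σ) K] : Function.Injective (algebraMap k[X] K) := by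
  rw [IsScalarTower.algebraMap_eq k[X] (CoordRing k ε ρ σ)]
  exact (IsFractionRing.injective (CoordRing k ε ρ σ) K).comp QuadraticAlgebra.algebraMap_injective

/-- Integral closedness of `k[X]`, for fractions in an extension field. -/
theorem dvd_of_isIntegral_div {f g : k[X]} (hg : g ≠ 0)
    (hinj : Function.Injective (algebraMap k[X] K))
    (hint : IsIntegral k[X] (algebraMap k[X] K f / algebraMap k[X] K g)) : g ∣ f := by
  let φ : FractionRing k[X] →ₐ[k[X]] K := IsFractionRing.liftAlgHom (g := Algebra.ofId k[X] K) hinj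
  have hφ : φ (algebraMap _ _ f / algebraMap _ _ g) =
      algebraMap k[X] K f / algebraMap k[X] K g := by
    rw [map_div₀, AlgHom.commutes, AlgHom.commutes]
  rw [← hφ, isIntegral_algHom_iff φ φ.toRingHom.injective] at hint
  obtain ⟨c, hc⟩ := IsIntegrallyClosed.isIntegral_iff.1 hint
  have hg' : algebraMap k[X] (FractionRing k[X]) g ≠ 0 := by
    rwa [Ne, FaithfulSMul.algebraMap_eq_zero_iff]
  rw [eq_div_iff hg', ← map_mul] at hc
  exact ⟨c, by rw [mul_comm, IsFractionRing.injective k[X] (FractionRing k[X]) hc]⟩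

/-- Conjugation of the quadratic algebra, as a map of `k[X]`-algebras. -/
def conj : CoordRing k ε ρ σ →ₐ[k[X]] CoordRing k ε ρ σ :=
  { starRingEnd (CoordRing k ε ρ σ) with
    commutes' := fun r => by
      change star (algebraMap k[X] (CoordRing k ε ρ σ) r) = _
      rw [QuadraticAlgebra.algebraMap_eq, QuadraticAlgebra.star_mk]
      simp }

/-- If `z / g` is integral over `k[X]`, then so are `z / π` and its conjugate for every prime factor
`π` of `g`, so that `π` divides the trace and `π²` divides the norm of `z`. -/
theorem algebraMap_dvd_of_isIntegral_div (h : IsAnisotropic ε ρ σ) (hdisc : ε ^ 2 - 4 * ρ ≠ 0)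
    {g : k[X]} (hg : g ≠ 0) (z : CoordRing k ε ρ σ)
    (hint : IsIntegral k[X] (algebraMap _ K z / algebraMap k[X] K g)) :
    algebraMap k[X] (CoordRing k ε ρ σ) g ∣ z := by
  have := isDomain h
  have hinj := algebraMap_polynomial_injective ε ρ σ K
  have htower : ∀ f : k[X], algebraMap (CoordRing k ε ρ σ) K (algebraMap k[X] _ f) =
      algebraMap k[X] K f := fun f => (IsScalarTower.algebraMap_apply _ _ _ _).symm
  have hconj : Function.Injective ((IsScalarTower.toAlgHom k[X] (CoordRing k ε ρ σ) K).comp conj) :=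
    (IsFractionRing.injective (CoordRing k ε ρ σ) K).comp star_injective
  let τ : K →ₐ[k[X]] K := IsFractionRing.liftAlgHom hconj
  have hτ : ∀ z : CoordRing k ε ρ σ, τ (algebraMap _ K z) = algebraMap _ K (star z) := fun z =>
    IsFractionRing.lift_algebraMap hconj z
  induction g using UniqueFactorizationMonoid.induction_on_prime generalizing z with
  | h₁ => exact absurd rfl hg
  | h₂ g hu => exact (hu.map (algebraMap k[X] (CoordRing k ε ρ σ))).dvd
  | h₃ g π hg0 hπ ih =>
    have hπ0 : algebraMap k[X] K π ≠ 0 := (map_ne_zero_iff _ hinj).2 hπ.ne_zero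
    have hg1 : algebraMap k[X] K g ≠ 0 := (map_ne_zero_iff _ hinj).2 hg0
    have h1 : IsIntegral k[X] (algebraMap _ K z / algebraMap k[X] K π) := by
      have h2 : algebraMap _ K z / algebraMap k[X] K π =
          algebraMap k[X] K g * (algebraMap _ K z / algebraMap k[X] K (π * g)) := by
        rw [map_mul]; field_simp
      rw [h2]
      exact isIntegral_algebraMap.mul hint
    have h2 : IsIntegral k[X] (algebraMap _ K (star z) / algebraMap k[X] K π) := by
      have := h1.map τ
      rwa [map_div₀, hτ, AlgHom.commutes] at this
    have htr : π ∣ z.trace := by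
      apply dvd_of_isIntegral_div hπ.ne_zero hinj
      rw [← htower z.trace, QuadraticAlgebra.algebraMap_trace_eq_add_star, map_add, add_div]
      exact h1.add h2
    have hnm : π ^ 2 ∣ z.norm := by
      apply dvd_of_isIntegral_div (pow_ne_zero _ hπ.ne_zero) hinj
      rw [← htower z.norm, QuadraticAlgebra.algebraMap_norm_eq_mul_star, map_mul, map_pow,
        sq (algebraMap k[X] K π), mul_div_mul_comm]
      exact h1.mul h2
    obtain ⟨w, rfl⟩ := QuadraticAlgebra.algebraMap_dvd_iff.2
      (prime_dvd_of_dvd_trace_of_sq_dvd_norm h hdisc hπ htr hnm)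
    rw [map_mul]
    refine mul_dvd_mul_left _ (ih hg0 w ?_)
    rw [map_mul, map_mul, htower, mul_div_mul_left _ _ hπ0] at hint
    exact hint

end

/-- Denominators can be chosen in `k[X]`, by multiplication with the conjugate. -/
theorem exists_eq_div_polynomial (h : IsAnisotropic ε ρ σ) {K : Type w} [Field K]
    [Algebra (CoordRing k ε ρ σ) K] [IsFractionRing (CoordRing k ε ρ σ) K] (z : K) :
    ∃ (c : CoordRing k ε ρ σ) (g : k[X]), g ≠ 0 ∧
      z = algebraMap _ K c / algebraMap _ K (algebraMap k[X] (CoordRing k ε ρ σ) g) := by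
  have := isDomain h
  obtain ⟨a, b, hb, rfl⟩ := IsFractionRing.div_surjective (A := CoordRing k ε ρ σ) z
  have hb0 : b ≠ 0 := nonZeroDivisors.ne_zero hb
  refine ⟨a * star b, b.norm, norm_ne_zero h hb0, ?_⟩
  have h1 : algebraMap _ K (star b) ≠ 0 := by
    rw [Ne, FaithfulSMul.algebraMap_eq_zero_iff]
    simpa using hb0
  rw [QuadraticAlgebra.algebraMap_norm_eq_mul_star, map_mul, map_mul, mul_div_mul_right _ _ h1]

theorem isDedekindDomain (h : IsAnisotropic ε ρ σ) (hdisc : ε ^ 2 - 4 * ρ ≠ 0) :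
    IsDedekindDomain (CoordRing k ε ρ σ) := by
  have := isDomain h
  have hnoeth : IsNoetherianRing (CoordRing k ε ρ σ) :=
    IsNoetherianRing.of_finite k[X] _
  have hdim : Ring.DimensionLEOne (CoordRing k ε ρ σ) := by
    refine ⟨fun {P} hP0 hP => ?_⟩
    refine Ideal.isMaximal_of_isIntegral_of_isMaximal_comap (R := k[X]) P ?_
    exact Ideal.IsPrime.isMaximal inferInstance (mt Ideal.eq_bot_of_comap_eq_bot hP0)
  have hic : IsIntegrallyClosed (CoordRing k ε ρ σ) := by
    rw [isIntegrallyClosed_iff (FractionRing (CoordRing k ε ρ σ))]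
    intro x hx
    obtain ⟨c, g, hg, rfl⟩ := exists_eq_div_polynomial h x
    have hx' := isIntegral_trans (R := k[X]) _ hx
    rw [← IsScalarTower.algebraMap_apply] at hx'
    obtain ⟨w, rfl⟩ := algebraMap_dvd_of_isIntegral_div h hdisc hg c hx'
    refine ⟨w, ?_⟩
    have hg1 : algebraMap _ (FractionRing (CoordRing k ε ρ σ))
        (algebraMap k[X] (CoordRing k ε ρ σ) g) ≠ 0 := by
      rw [← IsScalarTower.algebraMap_apply]
      exact (map_ne_zero_iff _ (algebraMap_polynomial_injective ε ρ σ _)).2 hg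
    rw [map_mul, mul_div_cancel_left₀ _ hg1]
  exact { }

end IntegrallyClosed

end CoordRing

/-! ### Places and discrete valuations -/

section PlaceOfValuation

variable {k : Type u} {K : Type w} [Field k] [Field K] [Algebra k K]

local notation "ℤₘ₀" => WithZero (Multiplicative ℤ)

/-- A surjective discrete valuation is determined by its valuation ring. -/
theorem valuation_eq_of_forall_le_one_iff {v w : Valuation K ℤₘ₀}
    (hv : Function.Surjective v) (hw : Function.Surjective w)
    (h : ∀ x, v x ≤ 1 ↔ w x ≤ 1) : v = w := by
  have heq : v.IsEquiv w := Valuation.isEquiv_of_val_le_one fun {x} => h x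
  have hlt : ∀ {x y}, v x < v y ↔ w x < w y := heq.lt_iff_lt
  obtain ⟨π, hπ⟩ := hv (WithZero.exp (-1))
  have hone : ∀ a : ℤₘ₀, a < 1 ↔ a ≤ WithZero.exp (-1) := by
    intro a
    cases a with
    | zero => simp
    | coe a =>
      change WithZero.exp (a.toAdd) < WithZero.exp 0 ↔ WithZero.exp (a.toAdd) ≤ _
      rw [WithZero.exp_lt_exp, WithZero.exp_le_exp]
      omega
  have hwπ : w π = WithZero.exp (-1) := by
    apply le_antisymm
    · rw [← hone, ← w.map_one, ← hlt, hπ, v.map_one, hone]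
    · obtain ⟨π', hπ'⟩ := hw (WithZero.exp (-1))
      rw [← hπ', ← heq.le_iff_le, hπ, ← hone, ← v.map_one, hlt, hπ', w.map_one, hone]
  ext x
  by_cases hx : x = 0
  · simp [hx]
  obtain ⟨n, hn⟩ : ∃ n : ℤ, v x = v (π ^ n) := by
    refine ⟨-(WithZero.log (v x)), ?_⟩
    rw [map_zpow₀, hπ, ← WithZero.exp_zsmul]
    simp [WithZero.exp_log ((v.ne_zero_iff).2 hx)]
  rw [hn, heq.eq_iff.1 hn, map_zpow₀, map_zpow₀, hπ, hwπ]

theorem Place.mem_ring_iff (P : Place k K) {x : K} : x ∈ P.ring ↔ P.val x ≤ 1 := by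
  constructor
  · intro hx
    exact P.ideal.valuation_le_one (K := K) (⟨x, hx⟩ : P.ring)
  · intro hx
    obtain ⟨n, ⟨d, hd⟩, h⟩ := P.ideal.exists_primeCompl_mul_eq_of_integer x hx
    have hd : IsUnit d := by
      by_contra hd'
      exact hd ((IsLocalRing.mem_maximalIdeal d).2 hd')
    obtain ⟨e, he⟩ := hd.exists_right_inv
    have h1 : x = algebraMap P.ring K (n * e) := by
      rw [map_mul, ← h, mul_assoc, ← map_mul, he, map_one, mul_one]
    rw [h1]
    exact (n * e).2

theorem Place.val_surjective (P : Place k K) : Function.Surjective P.val :=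
  P.ideal.valuation_surjective K

theorem Place.val_eq (P : Place k K) {v : Valuation K ℤₘ₀} (hv : Function.Surjective v)
    (h : ∀ x, x ∈ P.ring ↔ v x ≤ 1) : P.val = v :=
  valuation_eq_of_forall_le_one_iff P.val_surjective hv fun x => by rw [← P.mem_ring_iff, h]

/-- The place given by a surjective discrete valuation that is trivial on `k`. -/
def Place.ofValuation (v : Valuation K ℤₘ₀) (hv : Function.Surjective v)
    (hk : ∀ a : k, v (algebraMap k K a) ≤ 1) : Place k K where
  ring := v.valuationSubring
  algebraMap_mem := hk
  isDVR := by
    have : v.IsNontrivial := by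
      obtain ⟨π, hπ⟩ := hv (WithZero.exp (-1))
      refine ⟨⟨π, ?_, ?_⟩⟩ <;> rw [hπ]
      · exact WithZero.exp_ne_zero
      · rw [← WithZero.exp_zero, Ne, WithZero.exp_inj]; norm_num
    exact v.valuationSubring_isDiscreteValuationRing

theorem Place.val_ofValuation (v : Valuation K ℤₘ₀) (hv : Function.Surjective v)
    (hk : ∀ a : k, v (algebraMap k K a) ≤ 1) : (Place.ofValuation v hv hk).val = v :=
  Place.val_eq _ hv fun _ => Iff.rfl

/-- An element is integral at a place if it satisfies a monic quadratic equation with integral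
coefficients. -/
theorem Place.mem_of_mul_add_mem {P : Place k K} {z a : K} (ha : a ∈ P.ring)
    (hz : z * (z + a) ∈ P.ring) : z ∈ P.ring := by
  rcases P.ring.mem_or_inv_mem z with h1 | h1
  · exact h1
  · by_cases hz0 : z = 0
    · rw [hz0]; exact zero_mem _
    have h2 := mul_mem h1 hz
    rw [← mul_assoc, inv_mul_cancel₀ hz0, one_mul] at h2
    simpa using sub_mem h2 ha

theorem Place.val_algebraMap_eq_one {P : Place k K} {a : k} (ha : a ≠ 0) :
    P.val (algebraMap k K a) = 1 := by
  apply le_antisymm (P.val_algebraMap_le_one a)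
  have h1 := P.val_algebraMap_le_one a⁻¹
  have h2 : P.val (algebraMap k K a) * P.val (algebraMap k K a⁻¹) = 1 := by
    rw [← map_mul, ← map_mul, mul_inv_cancel₀ ha, map_one, map_one]
  rw [← h2]
  exact mul_le_of_le_one_right' h1

/-- Discrete valuation rings are maximal among the proper subrings of their fraction field. -/
theorem Place.eq_of_le {P P' : Place k K} (h : P.ring ≤ P'.ring) : P = P' := by
  ext1
  refine ValuationSubring.eq_of_le_of_ne_top P.ring h ?_
  intro htop
  obtain ⟨x, hx⟩ := P'.val_surjective (WithZero.exp 1)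
  have : x ∈ P'.ring := by rw [htop]; trivial
  rw [P'.mem_ring_iff, hx, ← WithZero.exp_zero, WithZero.exp_le_exp] at this
  norm_num at this

end PlaceOfValuation

/-! ### The function field of the conic and its places -/

namespace CoordRing

variable {k : Type u} [Field k] {ε ρ σ : k}

/-- The coordinate function `X` of the conic. -/
def x : CoordRing k ε ρ σ := ⟨X, 0⟩

/-- The coordinate function `Y` of the conic. -/
def y : CoordRing k ε ρ σ := ⟨0, 1⟩

theorem algebraMap_eq_mk (a : k) : algebraMap k (CoordRing k ε ρ σ) a = ⟨C a, 0⟩ := rfl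

theorem algebraMap_X : algebraMap k[X] (CoordRing k ε ρ σ) X = x := rfl

theorem algebraMap_C (a : k) : algebraMap k[X] (CoordRing k ε ρ σ) (C a) = algebraMap k _ a := rfl

theorem eq_add_mul_y (c : CoordRing k ε ρ σ) :
    c = algebraMap k[X] _ c.re + algebraMap k[X] _ c.im * y := by
  ext <;> simp [y, QuadraticAlgebra.algebraMap_eq]

theorem equation : (y : CoordRing k ε ρ σ) ^ 2 + algebraMap k _ ε * x * y
    + algebraMap k _ ρ * x ^ 2 + algebraMap k _ σ = 0 := by
  ext
  · simp [x, y, sq, algebraMap_eq_mk]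
  · simp [x, y, sq, algebraMap_eq_mk]

theorem poleOrder_x : (x : CoordRing k ε ρ σ).poleOrder = 1 := by simp [poleOrder, x]

theorem x_ne_zero : (x : CoordRing k ε ρ σ) ≠ 0 := fun h => by
  have := congrArg QuadraticAlgebra.re h
  exact X_ne_zero this

section ScalarTower

variable (K : Type w) [Field K] [Algebra (CoordRing k ε ρ σ) K] [Algebra k K]
  [IsScalarTower k (CoordRing k ε ρ σ) K]

local notation "ι" => algebraMap (CoordRing k ε ρ σ) K

theorem equation_field : (ι y) ^ 2 + algebraMap k K ε * ι x * ι y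
    + algebraMap k K ρ * (ι x) ^ 2 + algebraMap k K σ = 0 := by
  have := congrArg ι (equation (ε := ε) (ρ := ρ) (σ := σ))
  simpa only [map_add, map_mul, map_pow, map_zero, ← IsScalarTower.algebraMap_apply] using this

variable {K} in
/-- If `X` has a pole at a place, then `f(X) / Xⁿ` is congruent to the coefficient of degree `n`
of `f`, for `n ≥ deg f`. -/
theorem val_div_pow_sub_lt_one {P : Place k K} (hP : 1 < P.val (ι x)) (n : ℕ) (f : k[X])
    (hf : f.natDegree ≤ n) :
    P.val (ι (algebraMap k[X] _ f) / (ι x) ^ n - algebraMap k K (f.coeff n)) < 1 := by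
  induction n generalizing f with
  | zero =>
    rw [eq_C_of_natDegree_le_zero hf, algebraMap_C, ← IsScalarTower.algebraMap_apply]
    simp
  | succ n ih =>
    have hx : ι x ≠ 0 := fun h0 => by simp [h0] at hP
    have h1 := ih f.divX (by rw [natDegree_divX_eq_natDegree_tsub_one]; omega)
    rw [coeff_divX] at h1
    have h2 : ι (algebraMap k[X] _ f) / (ι x) ^ (n + 1) - algebraMap k K (f.coeff (n + 1)) =
        (ι (algebraMap k[X] _ f.divX) / (ι x) ^ n - algebraMap k K (f.coeff (n + 1)))
        + algebraMap k K (f.coeff 0) * ((ι x) ^ (n + 1))⁻¹ := by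
      have h3 : ι (algebraMap k[X] _ f) =
          ι (algebraMap k[X] _ f.divX) * ι x + algebraMap k K (f.coeff 0) := by
        conv_lhs => rw [← divX_mul_X_add f]
        rw [map_add, map_mul, map_add, map_mul, algebraMap_X, algebraMap_C,
          ← IsScalarTower.algebraMap_apply k]
      rw [h3]
      field_simp
      ring
    rw [h2]
    refine Valuation.map_add_lt _ h1 ?_
    rw [map_mul, map_inv₀, map_pow]
    exact (mul_le_of_le_one_left' (P.val_algebraMap_le_one _)).trans_lt
      (inv_lt_one_of_one_lt₀ (one_lt_pow₀ hP (by omega)))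

variable {K} in
theorem algebraMap_mem_of_x_mem {P : Place k K} (hP : ι x ∈ P.ring) (c : CoordRing k ε ρ σ) :
    ι c ∈ P.ring := by
  have hy : ι y ∈ P.ring := by
    refine Place.mem_of_mul_add_mem (a := algebraMap k K ε * ι x)
      (mul_mem (P.algebraMap_mem ε) hP) ?_
    have : ι y * (ι y + algebraMap k K ε * ι x) =
        -(algebraMap k K ρ * (ι x) ^ 2 + algebraMap k K σ) := by
      have := equation_field (ε := ε) (ρ := ρ) (σ := σ) K
      linear_combination this
    rw [this]
    exact neg_mem (add_mem (mul_mem (P.algebraMap_mem ρ) (pow_mem hP 2)) (P.algebraMap_mem σ))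
  have hf : ∀ f : k[X], ι (algebraMap k[X] _ f) ∈ P.ring := by
    intro f
    induction f using Polynomial.induction_on' with
    | add p q hp hq => rw [map_add, map_add]; exact add_mem hp hq
    | monomial n a =>
      rw [← C_mul_X_pow_eq_monomial, map_mul, map_mul, map_pow, map_pow, algebraMap_X,
        algebraMap_C, ← IsScalarTower.algebraMap_apply]
      exact mul_mem (P.algebraMap_mem a) (pow_mem hP n)
  rw [eq_add_mul_y c, map_add, map_mul]
  exact add_mem (hf _) (mul_mem (hf _) hy)

end ScalarTower

section FunctionField

variable (h : IsAnisotropic ε ρ σ) (K : Type w) [Field K] [Algebra (CoordRing k ε ρ σ) K]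
  [IsFractionRing (CoordRing k ε ρ σ) K]

local notation "ι" => algebraMap (CoordRing k ε ρ σ) K

theorem field_x_ne_zero (h : IsAnisotropic ε ρ σ) : ι x ≠ 0 := by
  have := isDomain h
  rw [Ne, FaithfulSMul.algebraMap_eq_zero_iff]
  exact x_ne_zero

/-- The valuation of the function field of the conic at infinity. -/
def fieldInftyValuation : Valuation K (WithZero (Multiplicative ℤ)) :=
  (inftyValuation h).extendToLocalization (S := nonZeroDivisors (CoordRing k ε ρ σ))
    (fun s hs hsupp => by
      have := isDomain h
      exact nonZeroDivisors.ne_zero hs ((inftyValuation_eq_zero_iff h).1 hsupp)) K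

theorem fieldInftyValuation_algebraMap (c : CoordRing k ε ρ σ) :
    fieldInftyValuation h K (ι c) = inftyValuation h c :=
  Valuation.extendToLocalization_apply_map_apply _ _ _ _

theorem fieldInftyValuation_x :
    fieldInftyValuation h K (ι x) = WithZero.exp 1 := by
  rw [fieldInftyValuation_algebraMap, inftyValuation_of_ne_zero h x_ne_zero, poleOrder_x]
  rfl

theorem fieldInftyValuation_surjective : Function.Surjective (fieldInftyValuation h K) := by
  intro a
  by_cases ha : a = 0
  · exact ⟨0, by rw [ha, map_zero]⟩
  · refine ⟨(ι x) ^ (WithZero.log a), ?_⟩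
    rw [map_zpow₀, fieldInftyValuation_x, ← WithZero.exp_zsmul]
    simp [WithZero.exp_log ha]

variable [Algebra k K] [IsScalarTower k (CoordRing k ε ρ σ) K]

theorem fieldInftyValuation_algebraMap_le_one (a : k) :
    fieldInftyValuation h K (algebraMap k K a) ≤ 1 := by
  rw [IsScalarTower.algebraMap_apply k (CoordRing k ε ρ σ) K, fieldInftyValuation_algebraMap]
  have := (inftyValuation_le_exp_iff h (z := algebraMap k (CoordRing k ε ρ σ) a) (n := 0)).2
    (by rw [← algebraMap_C, poleOrder_algebraMap]; simp)
  simpa using this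

/-- The place at infinity of the conic. -/
def inftyPlace : Place k K :=
  Place.ofValuation (fieldInftyValuation h K) (fieldInftyValuation_surjective h K)
    (fieldInftyValuation_algebraMap_le_one h K)

theorem val_inftyPlace : (inftyPlace h K).val = fieldInftyValuation h K :=
  Place.val_ofValuation _ _ _

theorem val_inftyPlace_algebraMap_le_iff {c : CoordRing k ε ρ σ} {n : ℕ} :
    (inftyPlace h K).val (ι c) ≤ WithZero.exp (n : ℤ) ↔ c.poleOrder ≤ n := by
  rw [val_inftyPlace, fieldInftyValuation_algebraMap, inftyValuation_le_exp_iff]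

theorem val_inftyPlace_polynomial {f : k[X]} (hf : f ≠ 0) :
    (inftyPlace h K).val (ι (algebraMap k[X] _ f)) = WithZero.exp (f.natDegree : ℤ) := by
  rw [val_inftyPlace, fieldInftyValuation_algebraMap, inftyValuation_of_ne_zero,
    poleOrder_algebraMap]
  rwa [Ne, FaithfulSMul.algebraMap_eq_zero_iff]

theorem val_inftyPlace_x : (inftyPlace h K).val (ι x) = WithZero.exp 1 := by
  rw [val_inftyPlace, fieldInftyValuation_x]

variable {K} in
/-- If `X` has a pole at a place, then `Y / X` is integral there, and the functions that are
integral at infinity are seen to be integral there by comparison with powers of `X`. -/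
theorem eq_inftyPlace_of_x_notMem {P : Place k K} (hP : ι x ∉ P.ring) : P = inftyPlace h K := by
  have hx := field_x_ne_zero K h
  have hP1 : 1 < P.val (ι x) := by rwa [P.mem_ring_iff, not_le] at hP
  have hxinv : (ι x)⁻¹ ∈ P.ring := (P.ring.mem_or_inv_mem _).resolve_left hP
  have hw : ι y / ι x ∈ P.ring := by
    refine Place.mem_of_mul_add_mem (P.algebraMap_mem ε) ?_
    have : ι y / ι x * (ι y / ι x + algebraMap k K ε) =
        -(algebraMap k K ρ + algebraMap k K σ * (ι x)⁻¹ ^ 2) := by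
      have := equation_field (ε := ε) (ρ := ρ) (σ := σ) K
      field_simp
      linear_combination this
    rw [this]
    exact neg_mem (add_mem (P.algebraMap_mem ρ) (mul_mem (P.algebraMap_mem σ) (pow_mem hxinv 2)))
  symm
  apply Place.eq_of_le
  intro z hz
  obtain ⟨c, g, hg, rfl⟩ := exists_eq_div_polynomial h z
  rw [Place.mem_ring_iff, map_div₀, val_inftyPlace_polynomial h K hg,
    div_le_one₀ WithZero.exp_pos, val_inftyPlace_algebraMap_le_iff, poleOrder_le_iff] at hz
  have hdiv : ∀ f : k[X], f.natDegree ≤ g.natDegree →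
      P.val (ι (algebraMap k[X] _ f) / (ι x) ^ g.natDegree) ≤ 1 := by
    intro f hf
    have h1 := (P.val.map_add _ _).trans
      (max_le (val_div_pow_sub_lt_one hP1 _ f hf).le
        (P.val_algebraMap_le_one (f.coeff g.natDegree)))
    rwa [sub_add_cancel] at h1
  have hgu : P.val (ι (algebraMap k[X] _ g) / (ι x) ^ g.natDegree) = 1 := by
    have h1 := val_div_pow_sub_lt_one hP1 _ g le_rfl
    have h2 : P.val (algebraMap k K (g.coeff g.natDegree)) = 1 :=
      Place.val_algebraMap_eq_one (leadingCoeff_ne_zero.2 hg)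
    have h3 := Valuation.map_add_eq_of_lt_left P.val (h1.trans_eq h2.symm)
    rwa [add_sub_cancel, h2] at h3
  have hz' : ι c / ι (algebraMap k[X] _ g) =
      (ι (algebraMap k[X] _ c.re) / (ι x) ^ g.natDegree
        + ι (algebraMap k[X] _ (X * c.im)) / (ι x) ^ g.natDegree * (ι y / ι x))
      / (ι (algebraMap k[X] _ g) / (ι x) ^ g.natDegree) := by
    conv_lhs => rw [eq_add_mul_y c]
    rw [map_add, map_mul ι, map_mul (algebraMap k[X] _) X, map_mul ι, algebraMap_X]
    field_simp
  rw [hz', Place.mem_ring_iff, map_div₀, hgu, div_one]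
  refine (P.val.map_add _ _).trans (max_le (hdiv _ hz.1) ?_)
  rw [map_mul]
  exact mul_le_one' (hdiv _ hz.2) (P.mem_ring_iff.1 hw)

variable [IsDedekindDomain (CoordRing k ε ρ σ)]

variable {K} in
theorem valuation_algebraMap_base_le_one (p : HeightOneSpectrum (CoordRing k ε ρ σ)) (a : k) :
    p.valuation K (algebraMap k K a) ≤ 1 := by
  rw [IsScalarTower.algebraMap_apply k (CoordRing k ε ρ σ) K]
  exact p.valuation_le_one _

/-- The place attached to a nonzero prime ideal of the affine coordinate ring. -/
def primePlace (p : HeightOneSpectrum (CoordRing k ε ρ σ)) : Place k K :=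
  Place.ofValuation (p.valuation K) (p.valuation_surjective K) (valuation_algebraMap_base_le_one p)

theorem val_primePlace (p : HeightOneSpectrum (CoordRing k ε ρ σ)) :
    (primePlace K p).val = p.valuation K :=
  Place.val_ofValuation _ _ _

theorem primePlace_injective :
    Function.Injective (primePlace (k := k) (ε := ε) (ρ := ρ) (σ := σ) K) := by
  intro p q hpq
  apply HeightOneSpectrum.eq_of_valuation_isEquiv_valuation (K := K)
  rw [← val_primePlace, ← val_primePlace, hpq]

theorem primePlace_ne_inftyPlace (p : HeightOneSpectrum (CoordRing k ε ρ σ)) :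
    primePlace K p ≠ inftyPlace h K := by
  intro heq
  have h1 : (primePlace K p).val (ι x) ≤ 1 := by
    rw [val_primePlace]; exact p.valuation_le_one _
  rw [heq, val_inftyPlace_x, ← WithZero.exp_zero, WithZero.exp_le_exp] at h1
  norm_num at h1

variable {K} in
/-- The places of the function field of the conic are the place at infinity and those coming from
the nonzero primes of the affine coordinate ring. -/
theorem exists_eq_primePlace {P : Place k K} (hP : P ≠ inftyPlace h K) :
    ∃ p : HeightOneSpectrum (CoordRing k ε ρ σ), P = primePlace K p := by
  have hx : ι x ∈ P.ring := by
    by_contra hx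
    exact hP (eq_inftyPlace_of_x_notMem h hx)
  have hc := algebraMap_mem_of_x_mem hx
  let φ : CoordRing k ε ρ σ →+* P.ring := RingHom.codRestrict ι P.ring hc
  have hmem : ∀ c, c ∈ P.ideal.asIdeal.comap φ ↔ P.val (ι c) < 1 := fun c =>
    (P.ideal.valuation_lt_one_iff_mem (K := K) (φ c)).symm
  have hprime : (P.ideal.asIdeal.comap φ).IsPrime := Ideal.IsPrime.comap φ
  refine ⟨⟨P.ideal.asIdeal.comap φ, hprime, ?_⟩, ?_⟩
  · intro hbot
    have h1 : ∀ c : CoordRing k ε ρ σ, c ≠ 0 → P.val (ι c) = 1 := by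
      intro c hc0
      refine le_antisymm (P.mem_ring_iff.1 (hc c)) (not_lt.1 fun hlt => hc0 ?_)
      rwa [← hmem, hbot, Ideal.mem_bot] at hlt
    obtain ⟨z, hz⟩ := P.val_surjective (WithZero.exp 1)
    obtain ⟨a, b, hb, rfl⟩ := IsFractionRing.div_surjective (A := CoordRing k ε ρ σ) z
    have ha : a ≠ 0 := by
      rintro rfl
      rw [map_zero, zero_div, map_zero] at hz
      exact WithZero.exp_ne_zero hz.symm
    rw [map_div₀, h1 a ha, h1 b (nonZeroDivisors.ne_zero hb), div_one, ← WithZero.exp_zero,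
      WithZero.exp_inj] at hz
    norm_num at hz
  · symm
    apply Place.eq_of_le
    intro z hz
    rw [Place.mem_ring_iff, val_primePlace] at hz
    obtain ⟨n, ⟨d, hd⟩, h1⟩ := HeightOneSpectrum.exists_primeCompl_mul_eq_of_integer _ z hz
    have hd1 : P.val (ι d) = 1 :=
      le_antisymm (P.mem_ring_iff.1 (hc d)) (not_lt.1 fun hlt => hd ((hmem d).2 hlt))
    have h2 := congrArg P.val h1
    rw [map_mul, hd1, mul_one] at h2
    rw [Place.mem_ring_iff, h2, ← Place.mem_ring_iff]
    exact hc n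

theorem mem_integersAway_iff {z : K} :
    z ∈ integersAway (inftyPlace h K) ↔ ∃ c : CoordRing k ε ρ σ, ι c = z := by
  constructor
  · intro hz
    refine HeightOneSpectrum.mem_integers_of_valuation_le_one K z fun p => ?_
    rw [← val_primePlace, ← Place.mem_ring_iff]
    exact hz _ (primePlace_ne_inftyPlace h K p)
  · rintro ⟨c, rfl⟩ P hP
    obtain ⟨p, rfl⟩ := exists_eq_primePlace h hP
    rw [Place.mem_ring_iff, val_primePlace]
    exact p.valuation_le_one c

/-- The ring of functions which are integral away from infinity is the affine coordinate ring. -/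
def integersAwayEquiv : CoordRing k ε ρ σ ≃ₐ[k] integersAway (inftyPlace h K) :=
  AlgEquiv.ofBijective
    ((IsScalarTower.toAlgHom k (CoordRing k ε ρ σ) K).codRestrict (integersAway (inftyPlace h K))
      fun c => (mem_integersAway_iff h K).2 ⟨c, rfl⟩)
    ⟨fun a b hab => IsFractionRing.injective (CoordRing k ε ρ σ) K (congrArg Subtype.val hab),
      fun ⟨z, hz⟩ => by
        obtain ⟨c, hc⟩ := (mem_integersAway_iff h K).1 hz
        exact ⟨c, Subtype.ext hc⟩⟩

end FunctionField

end CoordRing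

/-! ### Residue fields -/

section ResidueField

variable {k : Type u} {K : Type w} [Field k] [Field K] [Algebra k K] (P : Place k K)

theorem Place.residue_eq_zero_iff {r : P.ring} :
    IsLocalRing.residue P.ring r = 0 ↔ P.val (r : K) < 1 := by
  rw [IsLocalRing.residue_eq_zero_iff]
  exact (P.ideal.valuation_lt_one_iff_mem (K := K) r).symm

theorem Place.smul_residue (a : k) (r : P.ring) :
    a • IsLocalRing.residue P.ring r =
      IsLocalRing.residue P.ring (algebraMap k P.ring a * r) := by
  rw [map_mul, Algebra.smul_def]; rfl

theorem Place.coe_algebraMap (a : k) : ((algebraMap k P.ring a : P.ring) : K) = algebraMap k K a :=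
  rfl

end ResidueField

namespace CoordRing

variable {k : Type u} [Field k] {ε ρ σ : k}
variable (h : IsAnisotropic ε ρ σ) (K : Type w) [Field K] [Algebra (CoordRing k ε ρ σ) K]
  [IsFractionRing (CoordRing k ε ρ σ) K] [Algebra k K] [IsScalarTower k (CoordRing k ε ρ σ) K]

local notation "ι" => algebraMap (CoordRing k ε ρ σ) K

theorem exists_natDegree_X_mul_sub_le {f g : k[X]} (hg : g ≠ 0)
    (hf : f.natDegree ≤ g.natDegree) :
    ∃ a : k, (X * (f - C a * g)).natDegree ≤ g.natDegree := by
  refine ⟨f.coeff g.natDegree / g.leadingCoeff, ?_⟩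
  set r := f - C (f.coeff g.natDegree / g.leadingCoeff) * g with hr
  have hr1 : r.natDegree ≤ g.natDegree :=
    (natDegree_sub_le_of_le hf (natDegree_C_mul_le _ _)).trans (max_self _).le
  have hr2 : r.coeff g.natDegree = 0 := by
    rw [hr, coeff_sub, coeff_C_mul, coeff_natDegree,
      div_mul_cancel₀ _ (leadingCoeff_ne_zero.2 hg), sub_self]
  by_cases hr0 : r = 0
  · simp [hr0]
  · rw [natDegree_X_mul hr0]
    have : r.natDegree ≠ g.natDegree := fun heq => by
      rw [← heq, coeff_natDegree, leadingCoeff_eq_zero] at hr2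
      exact hr0 hr2
    omega

/-- `Y / X` is integral at infinity. -/
theorem val_inftyPlace_y_div_x_le_one : (inftyPlace h K).val (ι y / ι x) ≤ 1 := by
  rw [map_div₀, val_inftyPlace_x]
  have : (inftyPlace h K).val (ι y) ≤ WithZero.exp ((1 : ℕ) : ℤ) :=
    (val_inftyPlace_algebraMap_le_iff h K).2 (by simp [poleOrder, y])
  exact div_le_one_of_le₀ this zero_le

theorem poleOrder_eq_zero_iff {c : CoordRing k ε ρ σ} :
    c.poleOrder = 0 ↔ ∃ a : k, c = algebraMap k _ a := by
  constructor
  · intro hc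
    obtain ⟨h1, h2⟩ := poleOrder_le_iff.1 hc.le
    have h3 : c.im = 0 := by
      by_contra h3
      rw [natDegree_X_mul h3] at h2
      omega
    exact ⟨c.re.coeff 0, QuadraticAlgebra.ext (eq_C_of_natDegree_le_zero h1) h3⟩
  · rintro ⟨a, rfl⟩
    rw [← algebraMap_C, poleOrder_algebraMap, natDegree_C]

/-- The residue field at infinity has the basis `1, Y / X`. -/
theorem degree_inftyPlace : (inftyPlace h K).degree = 2 := by
  set P := inftyPlace h K with hP
  have hx0 := field_x_ne_zero K h
  let w : P.ring := ⟨ι y / ι x, P.mem_ring_iff.2 (val_inftyPlace_y_div_x_le_one h K)⟩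
  let φ : (k × k) →ₗ[k] IsLocalRing.ResidueField P.ring :=
    (LinearMap.toSpanSingleton k _ (IsLocalRing.residue P.ring 1)).coprod
      (LinearMap.toSpanSingleton k _ (IsLocalRing.residue P.ring w))
  have hφ : ∀ a b : k, φ (a, b) =
      IsLocalRing.residue P.ring (algebraMap k P.ring a * 1 + algebraMap k P.ring b * w) := by
    intro a b
    rw [map_add, ← P.smul_residue, ← P.smul_residue]
    simp [φ]
  have hbij : Function.Bijective φ := by
    constructor
    · rw [← LinearMap.ker_eq_bot, LinearMap.ker_eq_bot']
      rintro ⟨a, b⟩ hab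
      rw [hφ, P.residue_eq_zero_iff] at hab
      have h1 : ((algebraMap k P.ring a * 1 + algebraMap k P.ring b * w : P.ring) : K) =
          ι (⟨C a * X, C b⟩ : CoordRing k ε ρ σ) / ι x := by
        have : (⟨C a * X, C b⟩ : CoordRing k ε ρ σ) =
            algebraMap k _ a * x + algebraMap k _ b * y := by
          ext <;> simp [x, y, algebraMap_eq_mk]
        rw [this, map_add, map_mul, map_mul, ← IsScalarTower.algebraMap_apply k,
          ← IsScalarTower.algebraMap_apply k]
        push_cast
        rw [P.coe_algebraMap, P.coe_algebraMap]
        simp only [w]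
        field_simp
      rw [h1, map_div₀, hP, val_inftyPlace_x, div_lt_one₀ WithZero.exp_pos] at hab
      have h2 : (inftyPlace h K).val (ι (⟨C a * X, C b⟩ : CoordRing k ε ρ σ)) ≤
          WithZero.exp ((0 : ℕ) : ℤ) := by
        by_cases h0 : (⟨C a * X, C b⟩ : CoordRing k ε ρ σ) = 0
        · rw [h0]; simp
        rw [val_inftyPlace, fieldInftyValuation_algebraMap, inftyValuation_of_ne_zero h h0,
          WithZero.exp_lt_exp] at hab
        rw [val_inftyPlace_algebraMap_le_iff]
        omega
      rw [val_inftyPlace_algebraMap_le_iff, poleOrder_le_iff] at h2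
      obtain ⟨h3, h4⟩ := h2
      have ha : a = 0 := by
        by_contra ha
        rw [natDegree_C_mul_X a ha] at h3
        omega
      have hb : b = 0 := by
        by_contra hb
        rw [mul_comm, natDegree_C_mul_X b hb] at h4
        omega
      rw [ha, hb]; rfl
    · intro r
      obtain ⟨⟨z, hz⟩, rfl⟩ := IsLocalRing.residue_surjective r
      have hz' := hz
      obtain ⟨c, g, hg, rfl⟩ := exists_eq_div_polynomial h z
      rw [Place.mem_ring_iff, map_div₀, hP, val_inftyPlace_polynomial h K hg,
        div_le_one₀ WithZero.exp_pos, val_inftyPlace_algebraMap_le_iff, poleOrder_le_iff] at hz'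
      obtain ⟨a, ha⟩ := exists_natDegree_X_mul_sub_le hg hz'.1
      obtain ⟨b, hb⟩ := exists_natDegree_X_mul_sub_le hg hz'.2
      refine ⟨(a, b), ?_⟩
      symm
      rw [hφ, ← sub_eq_zero, ← map_sub, P.residue_eq_zero_iff]
      let d : CoordRing k ε ρ σ := ⟨X * (c.re - C a * g), X * c.im - C b * g⟩
      have hg0 : ι (algebraMap k[X] _ g) ≠ 0 := by
        have := isDomain h
        rwa [Ne, FaithfulSMul.algebraMap_eq_zero_iff, FaithfulSMul.algebraMap_eq_zero_iff]
      have h1 : ((⟨ι c / ι (algebraMap k[X] _ g), hz⟩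
          - (algebraMap k P.ring a * 1 + algebraMap k P.ring b * w) : P.ring) : K) =
          ι d / (ι x * ι (algebraMap k[X] _ g)) := by
        have : d = x * c - (algebraMap k _ a * x + algebraMap k _ b * y) * algebraMap k[X] _ g := by
          refine QuadraticAlgebra.ext ?_ ?_
          · simp [d, x, y, algebraMap_eq_mk]; ring
          · simp [d, x, y, algebraMap_eq_mk]
        rw [this, map_sub, map_mul, map_mul, map_add, map_mul, map_mul,
          ← IsScalarTower.algebraMap_apply k (CoordRing k ε ρ σ) K,
          ← IsScalarTower.algebraMap_apply k (CoordRing k ε ρ σ) K]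
        push_cast
        rw [P.coe_algebraMap, P.coe_algebraMap]
        simp only [w]
        field_simp
      rw [h1, map_div₀, map_mul, hP, val_inftyPlace_x, val_inftyPlace_polynomial h K hg,
        ← WithZero.exp_add, div_lt_one₀ WithZero.exp_pos]
      refine ((val_inftyPlace_algebraMap_le_iff h K (n := g.natDegree)).2 ?_).trans_lt ?_
      · exact poleOrder_le_iff.2 ⟨ha, hb⟩
      · rw [WithZero.exp_lt_exp]; omega
  rw [Place.degree, ← (LinearEquiv.ofBijective φ hbij).finrank_eq]
  simp

variable [IsDedekindDomain (CoordRing k ε ρ σ)]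

/-- The residue field at a prime is the quotient of the affine coordinate ring. -/
theorem degree_primePlace (p : HeightOneSpectrum (CoordRing k ε ρ σ)) :
    (primePlace K p).degree = Module.finrank k (CoordRing k ε ρ σ ⧸ p.asIdeal) := by
  set P := primePlace K p
  have hval : P.val = p.valuation K := val_primePlace K p
  have hc : ∀ c : CoordRing k ε ρ σ, ι c ∈ P.ring := fun c => by
    rw [P.mem_ring_iff, hval]
    exact p.valuation_le_one c
  let φ : CoordRing k ε ρ σ →ₐ[k] P.ring :=
    { RingHom.codRestrict ι P.ring hc with
      commutes' := fun a => Subtype.ext (IsScalarTower.algebraMap_apply k _ K a).symm }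
  let res : P.ring →ₐ[k] IsLocalRing.ResidueField P.ring :=
    { IsLocalRing.residue P.ring with commutes' := fun a => rfl }
  let ψ := res.comp φ
  have hψ : ∀ c, ψ c = 0 ↔ c ∈ p.asIdeal := fun c => by
    change IsLocalRing.residue P.ring (φ c) = 0 ↔ _
    rw [P.residue_eq_zero_iff, hval]
    exact p.valuation_lt_one_iff_mem c
  have hker : RingHom.ker ψ = p.asIdeal := by
    ext c; rw [RingHom.mem_ker, hψ]
  have hsurj : Function.Surjective ψ := by
    intro r
    obtain ⟨⟨z, hz⟩, rfl⟩ := IsLocalRing.residue_surjective r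
    have hz' := hz
    rw [P.mem_ring_iff, hval] at hz'
    obtain ⟨n, ⟨d, hd⟩, h1⟩ := p.exists_primeCompl_mul_eq_of_integer z hz'
    have hmax := p.isMaximal
    obtain ⟨e, i, hi, hei⟩ := hmax.exists_inv hd
    refine ⟨n * e, ?_⟩
    have hd1 : (⟨z, hz⟩ : P.ring) * φ d = φ n := Subtype.ext h1
    have hde : ψ e * ψ d = 1 := by
      rw [← map_one ψ, ← hei, map_add, (hψ i).2 hi, add_zero, map_mul]
    have : ψ n = res ⟨z, hz⟩ * ψ d := by
      change res (φ n) = _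
      rw [← hd1, map_mul]; rfl
    change ψ (n * e) = res ⟨z, hz⟩
    rw [map_mul, this, mul_assoc, mul_comm (ψ d), hde, mul_one]
  rw [Place.degree]
  exact (((Ideal.quotientEquivAlgOfEq k hker.symm).trans
    (Ideal.quotientKerAlgEquivOfSurjective hsurj)).toLinearEquiv.finrank_eq).symm

end CoordRing

/-! ### Dimensions of ideal quotients and of spaces of functions with bounded poles -/

section IdealQuotients

theorem prod_le_pow {R : Type w} [CommRing R] (S : Finset (HeightOneSpectrum R))
    {a : HeightOneSpectrum R → ℕ} (ha : ∀ p ∉ S, a p = 0) (p : HeightOneSpectrum R) :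
    ∏ q ∈ S, q.asIdeal ^ a q ≤ p.asIdeal ^ a p := by
  by_cases hp : p ∈ S
  · exact Ideal.le_of_dvd (Finset.dvd_prod_of_mem _ hp)
  · rw [ha p hp, pow_zero, Ideal.one_eq_top]
    exact le_top

variable {k : Type u} [Field k] {R : Type w} [CommRing R] [IsDedekindDomain R] [Algebra k R]

/-- The ideal `J` is of the form `I J + (a)`, and multiplication by `a` identifies `R / I` with
`J / I J`. -/
theorem finrank_quotient_mul {I J : Ideal R} (hI : I ≠ ⊥) (hJ : J ≠ ⊥)
    [Module.Finite k (R ⧸ I * J)] :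
    Module.finrank k (R ⧸ I * J) = Module.finrank k (R ⧸ I) + Module.finrank k (R ⧸ J) := by
  have hle : I * J ≤ J := Ideal.mul_le_right
  obtain ⟨a, ha⟩ := IsDedekindDomain.exists_sup_span_eq hle (mul_ne_zero hI hJ)
  let f : R →ₗ[k] R ⧸ I * J :=
    (Ideal.Quotient.mkₐ k (I * J)).toLinearMap.comp (LinearMap.mulRight k a)
  have hf : ∀ c, f c = Ideal.Quotient.mk (I * J) (c * a) := fun c => rfl
  let g : R ⧸ I * J →ₗ[k] R ⧸ J := (Ideal.Quotient.factorₐ k hle).toLinearMap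
  have hg : ∀ c, g (Ideal.Quotient.mk (I * J) c) = Ideal.Quotient.mk J c := fun c => rfl
  have hkerf : LinearMap.ker f = I.restrictScalars k := by
    ext c
    rw [LinearMap.mem_ker, hf, Ideal.Quotient.eq_zero_iff_mem, Submodule.restrictScalars_mem]
    constructor
    · intro hc
      have h1 : Ideal.span {c} * J ≤ I * J := by
        conv_lhs => rw [← ha]
        rw [Ideal.mul_sup, Ideal.span_singleton_mul_span_singleton, sup_le_iff,
          Ideal.span_singleton_le_iff_mem]
        exact ⟨Ideal.mul_le_right, hc⟩
      rw [← Ideal.dvd_iff_le] at h1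
      exact (Ideal.dvd_span_singleton).1 ((mul_dvd_mul_iff_right hJ).1 h1)
    · intro hc
      exact Ideal.mul_mem_mul hc (ha ▸ Ideal.mem_sup_right (Ideal.mem_span_singleton_self a))
  have hkerg : LinearMap.ker g = LinearMap.range f := by
    ext c
    obtain ⟨c, rfl⟩ := Ideal.Quotient.mk_surjective c
    rw [LinearMap.mem_ker, hg, Ideal.Quotient.eq_zero_iff_mem, LinearMap.mem_range]
    constructor
    · intro hc
      rw [← ha, Submodule.mem_sup] at hc
      obtain ⟨y, hy, z, hz, rfl⟩ := hc
      obtain ⟨d, rfl⟩ := Ideal.mem_span_singleton'.1 hz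
      refine ⟨d, ?_⟩
      rw [hf, map_add, Ideal.Quotient.eq_zero_iff_mem.2 hy, zero_add]
    · rintro ⟨d, hd⟩
      rw [hf, Ideal.Quotient.eq] at hd
      have h1 : d * a ∈ J :=
        J.mul_mem_left _ (ha ▸ Ideal.mem_sup_right (Ideal.mem_span_singleton_self a))
      have := sub_mem h1 (hle hd)
      rwa [sub_sub_cancel] at this
  have hgsurj : Function.Surjective g := Ideal.Quotient.factor_surjective hle
  have h1 := g.finrank_range_add_finrank_ker
  rw [LinearMap.range_eq_top.2 hgsurj, finrank_top, hkerg,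
    ← f.quotKerEquivRange.finrank_eq, (Submodule.quotEquivOfEq _ _ hkerf).finrank_eq,
    (Submodule.Quotient.restrictScalarsEquiv k I).finrank_eq] at h1
  omega

theorem finrank_quotient_prod (hfin : ∀ I : Ideal R, I ≠ ⊥ → Module.Finite k (R ⧸ I))
    (S : Finset (HeightOneSpectrum R)) (a : HeightOneSpectrum R → ℕ) :
    Module.finrank k (R ⧸ ∏ p ∈ S, p.asIdeal ^ a p) =
      ∑ p ∈ S, a p * Module.finrank k (R ⧸ p.asIdeal) := by
  have hone : Module.finrank k (R ⧸ (1 : Ideal R)) = 0 := by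
    have : Subsingleton (R ⧸ (1 : Ideal R)) := Ideal.Quotient.subsingleton_iff.2 Ideal.one_eq_top
    exact Module.finrank_zero_of_subsingleton
  have hpow : ∀ (p : HeightOneSpectrum R) (n : ℕ),
      Module.finrank k (R ⧸ p.asIdeal ^ n) = n * Module.finrank k (R ⧸ p.asIdeal) := by
    intro p n
    induction n with
    | zero => rw [pow_zero, hone, zero_mul]
    | succ n ih =>
      have := hfin (p.asIdeal ^ n * p.asIdeal) (mul_ne_zero (pow_ne_zero _ p.ne_bot) p.ne_bot)
      rw [pow_succ, finrank_quotient_mul (pow_ne_zero _ p.ne_bot) p.ne_bot, ih]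
      ring
  induction S using Finset.cons_induction with
  | empty => rw [Finset.prod_empty, hone, Finset.sum_empty]
  | cons p S hp ih =>
    have h1 : p.asIdeal ^ a p ≠ ⊥ := pow_ne_zero _ p.ne_bot
    have h2 : ∏ q ∈ S, q.asIdeal ^ a q ≠ ⊥ :=
      Finset.prod_ne_zero_iff.2 fun q _ => pow_ne_zero _ q.ne_bot
    have := hfin _ (mul_ne_zero h1 h2)
    rw [Finset.prod_cons, Finset.sum_cons, finrank_quotient_mul h1 h2, ih, hpow]

/-- The product `∏ p ^ a p` has an element whose order at a given prime `p` is at most `a p`. -/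
theorem exists_mem_prod_exp_le_intValuation (S : Finset (HeightOneSpectrum R))
    {a : HeightOneSpectrum R → ℕ} (ha : ∀ p ∉ S, a p = 0) (p : HeightOneSpectrum R) :
    ∃ s ∈ ∏ q ∈ S, q.asIdeal ^ a q, WithZero.exp (-(a p : ℤ)) ≤ p.intValuation s := by
  classical
  by_contra! H
  have hlt : ∀ s ∈ ∏ q ∈ S, q.asIdeal ^ a q, s ∈ p.asIdeal ^ (a p + 1) := by
    intro s hs
    rw [← p.intValuation_le_pow_iff_mem]
    have h1 := H s hs
    by_cases hs0 : s = 0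
    · simp [hs0]
    have hv := p.intValuation_ne_zero s hs0
    rw [← WithZero.exp_log hv] at h1 ⊢
    rw [WithZero.exp_lt_exp] at h1
    rw [WithZero.exp_le_exp]
    push_cast
    omega
  have hdvd : p.asIdeal ^ (a p + 1) ∣ ∏ q ∈ S, q.asIdeal ^ a q := Ideal.dvd_iff_le.2 hlt
  have hprime : Prime p.asIdeal := Ideal.prime_of_isPrime p.ne_bot p.isPrime
  have hfac : ∏ q ∈ S, q.asIdeal ^ a q =
      p.asIdeal ^ a p * ∏ q ∈ S.erase p, q.asIdeal ^ a q := by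
    by_cases hp : p ∈ S
    · exact (Finset.mul_prod_erase S _ hp).symm
    · rw [ha p hp, pow_zero, one_mul, Finset.erase_eq_of_notMem hp]
  rw [hfac, pow_succ] at hdvd
  have h2 := (mul_dvd_mul_iff_left (pow_ne_zero _ p.ne_bot)).1 hdvd
  obtain ⟨q, hq, hpq⟩ := hprime.exists_mem_finset_dvd h2
  have h3 : q.asIdeal ≤ p.asIdeal := Ideal.dvd_iff_le.1 (hprime.dvd_of_dvd_pow hpq)
  have h4 : q.asIdeal = p.asIdeal := q.isMaximal.eq_of_le p.isPrime.ne_top h3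
  exact (Finset.mem_erase.1 hq).1 (HeightOneSpectrum.ext h4)

end IdealQuotients

namespace CoordRing

variable {k : Type u} [Field k] {ε ρ σ : k}

theorem finrank_quotient_span_polynomial (h : IsAnisotropic ε ρ σ) {f : k[X]} (hf : f ≠ 0) :
    Module.finrank k (CoordRing k ε ρ σ ⧸ Ideal.span {algebraMap k[X] (CoordRing k ε ρ σ) f}) =
      2 * f.natDegree := by
  have := isDomain h
  rw [finrank_quotient_span_eq_natDegree_norm (QuadraticAlgebra.basis _ _),
    Algebra.norm_algebraMap_of_basis (QuadraticAlgebra.basis _ _)]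
  · simp
  · rwa [Ne, FaithfulSMul.algebraMap_eq_zero_iff]

theorem exists_polynomial_mem (h : IsAnisotropic ε ρ σ) {I : Ideal (CoordRing k ε ρ σ)}
    (hI : I ≠ ⊥) : ∃ f : k[X], f ≠ 0 ∧ algebraMap k[X] _ f ∈ I := by
  obtain ⟨z, hz, hz0⟩ := Submodule.exists_mem_ne_zero_of_ne_bot hI
  refine ⟨z.norm, norm_ne_zero h hz0, ?_⟩
  rw [QuadraticAlgebra.algebraMap_norm_eq_mul_star]
  exact I.mul_mem_right _ hz

theorem finite_quotient (h : IsAnisotropic ε ρ σ) {I : Ideal (CoordRing k ε ρ σ)}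
    (hI : I ≠ ⊥) : Module.Finite k (CoordRing k ε ρ σ ⧸ I) := by
  obtain ⟨f, hf, hfI⟩ := exists_polynomial_mem h hI
  have hX : algebraMap k[X] _ (f * X) ∈ I := by
    rw [map_mul]; exact I.mul_mem_right _ hfI
  -- the factor `X` keeps the dimension positive when `f` is constant
  have hfin : Module.Finite k
      (CoordRing k ε ρ σ ⧸ Ideal.span {algebraMap k[X] (CoordRing k ε ρ σ) (f * X)}) := by
    apply Module.finite_of_finrank_pos
    rw [finrank_quotient_span_polynomial h (mul_ne_zero hf X_ne_zero), natDegree_mul_X hf]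
    omega
  have hle : Ideal.span {algebraMap k[X] (CoordRing k ε ρ σ) (f * X)} ≤ I :=
    (Ideal.span_singleton_le_iff_mem I).2 hX
  exact Module.Finite.of_surjective (Ideal.Quotient.factorₐ k hle).toLinearMap
    (Ideal.Quotient.factor_surjective hle)

variable (k ε ρ σ) in
/-- The space of functions on the affine conic with pole order at most `n` at infinity. -/
def poleLE (n : ℕ) : Submodule k (CoordRing k ε ρ σ) where
  carrier := {z | z.poleOrder ≤ n}
  zero_mem' := by simp [poleOrder]
  add_mem' {a b} ha hb := (poleOrder_add_le a b).trans (max_le ha hb)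
  smul_mem' c z hz := by
    obtain ⟨h1, h2⟩ := poleOrder_le_iff.1 hz
    refine poleOrder_le_iff.2 ⟨?_, ?_⟩
    · exact (natDegree_smul_le c z.re).trans h1
    · rw [QuadraticAlgebra.im_smul, mul_smul_comm]
      exact (natDegree_smul_le c _).trans h2

theorem mem_poleLE {n : ℕ} {z : CoordRing k ε ρ σ} : z ∈ poleLE k ε ρ σ n ↔ z.poleOrder ≤ n :=
  Iff.rfl

variable (k ε ρ σ) in
/-- A function `p + q Y` has pole order at most `n` if and only if `deg p ≤ n` and `deg q < n`. -/
def poleLEEquiv (n : ℕ) : poleLE k ε ρ σ n ≃ₗ[k] degreeLT k (n + 1) × degreeLT k n where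
  toFun z := (⟨z.1.re, by
      rw [mem_degreeLT]
      exact (natDegree_le_iff_degree_le.1 (poleOrder_le_iff.1 z.2).1).trans_lt
        (by exact_mod_cast Nat.lt_succ_self n)⟩,
    ⟨z.1.im, by
      have h1 := (poleOrder_le_iff.1 z.2).2
      rw [mem_degreeLT]
      by_cases h0 : z.1.im = 0
      · rw [h0, degree_zero]; exact WithBot.bot_lt_coe n
      · rw [natDegree_X_mul h0] at h1
        exact (natDegree_lt_iff_degree_lt h0).1 h1⟩)
  invFun p := ⟨⟨p.1, p.2⟩, by
    have h1 := mem_degreeLT.1 p.1.2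
    have h2 := mem_degreeLT.1 p.2.2
    refine poleOrder_le_iff.2 ⟨?_, ?_⟩
    · by_cases h0 : (p.1 : k[X]) = 0
      · simp [h0]
      · exact Nat.lt_succ_iff.1 ((natDegree_lt_iff_degree_lt h0).2 h1)
    · by_cases h0 : (p.2 : k[X]) = 0
      · simp [h0]
      · change (X * (p.2 : k[X])).natDegree ≤ n
        rw [natDegree_X_mul h0]
        exact (natDegree_lt_iff_degree_lt h0).2 h2⟩
  left_inv z := rfl
  right_inv p := rfl
  map_add' z w := rfl
  map_smul' c z := rfl

theorem finite_poleLE (n : ℕ) : Module.Finite k (poleLE k ε ρ σ n) := by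
  have h1 := Module.Finite.equiv (degreeLTEquiv k (n + 1)).symm
  have h2 := Module.Finite.equiv (degreeLTEquiv k n).symm
  exact Module.Finite.equiv (poleLEEquiv k ε ρ σ n).symm

theorem finrank_poleLE (n : ℕ) : Module.finrank k (poleLE k ε ρ σ n) = 2 * n + 1 := by
  have h1 := Module.Finite.equiv (degreeLTEquiv k (n + 1)).symm
  have h2 := Module.Finite.equiv (degreeLTEquiv k n).symm
  rw [(poleLEEquiv k ε ρ σ n).finrank_eq, Module.finrank_prod, (degreeLTEquiv k (n + 1)).finrank_eq,
    (degreeLTEquiv k n).finrank_eq, Module.finrank_fin_fun, Module.finrank_fin_fun]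
  ring

end CoordRing

/-! ### Genus and constant field -/

namespace CoordRing

variable {k : Type u} [Field k] {ε ρ σ : k}

theorem aeval_x (f : k[X]) :
    aeval (x : CoordRing k ε ρ σ) f = algebraMap k[X] (CoordRing k ε ρ σ) f := by
  have := aeval_algHom_apply (IsScalarTower.toAlgHom k k[X] (CoordRing k ε ρ σ)) X f
  rwa [aeval_X_left_apply] at this

variable (h : IsAnisotropic ε ρ σ) (K : Type w) [Field K] [Algebra (CoordRing k ε ρ σ) K]
  [IsFractionRing (CoordRing k ε ρ σ) K] [Algebra k K] [IsScalarTower k (CoordRing k ε ρ σ) K]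
  [IsDedekindDomain (CoordRing k ε ρ σ)]

local notation "ι" => algebraMap (CoordRing k ε ρ σ) K

theorem mem_riemannRochSpace_iff {A : Divisor k K} {u : K} :
    u ∈ riemannRochSpace A ↔ (inftyPlace h K).val u ≤ WithZero.exp (A (inftyPlace h K)) ∧
      ∀ p : HeightOneSpectrum (CoordRing k ε ρ σ),
        p.valuation K u ≤ WithZero.exp (A (primePlace K p)) := by
  constructor
  · intro hu
    refine ⟨hu _, fun p => ?_⟩
    rw [← val_primePlace]
    exact hu _
  · rintro ⟨h1, h2⟩ P
    by_cases hP : P = inftyPlace h K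
    · rw [hP]; exact h1
    · obtain ⟨p, rfl⟩ := exists_eq_primePlace h hP
      rw [val_primePlace]
      exact h2 p

variable {K} in
/-- The primes of the affine coordinate ring that occur in a divisor. -/
def affineSupport (A : Divisor k K) : Finset (HeightOneSpectrum (CoordRing k ε ρ σ)) :=
  A.support.preimage (primePlace K) (primePlace_injective K).injOn

variable {K} in
theorem apply_eq_zero_of_notMem_affineSupport (A : Divisor k K)
    {p : HeightOneSpectrum (CoordRing k ε ρ σ)} (hp : p ∉ affineSupport A) :
    A (primePlace K p) = 0 := by
  rwa [affineSupport, Finset.mem_preimage, Finsupp.notMem_support_iff] at hp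

variable {K} in
theorem deg_eq (A : Divisor k K) :
    A.deg = A (inftyPlace h K) * 2 + ∑ p ∈ affineSupport (ε := ε) (ρ := ρ) (σ := σ) A,
      A (primePlace K p) * (Module.finrank k (CoordRing k ε ρ σ ⧸ p.asIdeal) : ℤ) := by
  classical
  have hmem : inftyPlace h K ∉ (affineSupport (ε := ε) (ρ := ρ) (σ := σ) A).map
      ⟨primePlace K, primePlace_injective K⟩ := by
    rw [Finset.mem_map]
    rintro ⟨p, -, hp⟩
    exact primePlace_ne_inftyPlace h K p hp
  have hsub : A.support ⊆ insert (inftyPlace h K) ((affineSupport (ε := ε) (ρ := ρ) (σ := σ) A).map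
      ⟨primePlace K, primePlace_injective K⟩) := by
    intro P hP
    by_cases hP' : P = inftyPlace h K
    · rw [hP']; exact Finset.mem_insert_self _ _
    · obtain ⟨p, rfl⟩ := exists_eq_primePlace h hP'
      refine Finset.mem_insert_of_mem (Finset.mem_map.2 ⟨p, ?_, rfl⟩)
      rwa [affineSupport, Finset.mem_preimage]
  rw [Divisor.deg, Finsupp.sum_of_support_subset A hsub (fun P n => n * (P.degree : ℤ))
    (fun _ _ => zero_mul _),
    Finset.sum_insert hmem, Finset.sum_map, degree_inftyPlace]
  simp only [Function.Embedding.coeFn_mk, degree_primePlace, Nat.cast_ofNat]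

variable {K} in
/-- Multiplication by a function `f` in `k[X]` with enough zeros embeds a Riemann–Roch space in the
space of functions with bounded pole order on the affine conic. -/
theorem exists_eq_algebraMap_mul {A : Divisor k K} {f : k[X]} (hf : f ≠ 0)
    (hfA : ∀ p : HeightOneSpectrum (CoordRing k ε ρ σ),
      p.intValuation (algebraMap k[X] _ f) ≤ WithZero.exp (-((A (primePlace K p)).toNat : ℤ)))
    {n : ℕ} (hn : (n : ℤ) = A (inftyPlace h K) + f.natDegree) {u : K}
    (hu : u ∈ riemannRochSpace A) :
    ∃ z ∈ poleLE k ε ρ σ n, ι z = u * ι (algebraMap k[X] _ f) := by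
  rw [mem_riemannRochSpace_iff h] at hu
  obtain ⟨h1, h2⟩ := hu
  obtain ⟨z, hz⟩ : u * ι (algebraMap k[X] _ f) ∈ (algebraMap (CoordRing k ε ρ σ) K).range := by
    refine HeightOneSpectrum.mem_integers_of_valuation_le_one K _ fun p => ?_
    rw [map_mul, p.valuation_of_algebraMap]
    refine (mul_le_mul' (h2 p) (hfA p)).trans ?_
    rw [← WithZero.exp_add, ← WithZero.exp_zero, WithZero.exp_le_exp]
    omega
  refine ⟨z, ?_, hz⟩
  rw [mem_poleLE, ← val_inftyPlace_algebraMap_le_iff h K, hz, map_mul,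
    val_inftyPlace_polynomial h K hf, hn, WithZero.exp_add]
  exact mul_le_mul' h1 le_rfl

variable {K} in
/-- Riemann's inequality in genus zero. With `I₊` and `I₋` the ideals of the positive and the
negative part of the divisor on the affine conic, choose a nonzero `f ∈ k[X] ∩ I₊` and write
`(f) = I₊ J`. Then `f L(A)` contains the functions of `J I₋` of bounded pole order; their number is
estimated from below by the dimension of all functions of bounded pole order, minus
`dim C / (J I₋)`. -/
theorem deg_sub_finrank_add_one_le (h : IsAnisotropic ε ρ σ) (A : Divisor k K) :
    A.deg - (Module.finrank k (riemannRochSpace A) : ℤ) + 1 ≤ 0 := by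
  have hfin : ∀ I : Ideal (CoordRing k ε ρ σ), I ≠ ⊥ → Module.Finite k (CoordRing k ε ρ σ ⧸ I) :=
    fun I hI => finite_quotient h hI
  let S := affineSupport (ε := ε) (ρ := ρ) (σ := σ) A
  let a : HeightOneSpectrum (CoordRing k ε ρ σ) → ℤ := fun p => A (primePlace K p)
  have ha : ∀ p ∉ S, a p = 0 := fun p hp => apply_eq_zero_of_notMem_affineSupport A hp
  have hap : ∀ p ∉ S, (a p).toNat = 0 := fun p hp => by rw [ha p hp]; rfl
  have ham : ∀ p ∉ S, (-a p).toNat = 0 := fun p hp => by rw [ha p hp]; rfl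
  obtain ⟨Ip, hIp⟩ : ∃ I, I = ∏ p ∈ S, p.asIdeal ^ (a p).toNat := ⟨_, rfl⟩
  obtain ⟨Im, hIm⟩ : ∃ I, I = ∏ p ∈ S, p.asIdeal ^ (-a p).toNat := ⟨_, rfl⟩
  have hIp0 : Ip ≠ ⊥ := by
    rw [hIp]; exact Finset.prod_ne_zero_iff.2 fun q _ => pow_ne_zero _ q.ne_bot
  have hIm0 : Im ≠ ⊥ := by
    rw [hIm]; exact Finset.prod_ne_zero_iff.2 fun q _ => pow_ne_zero _ q.ne_bot
  -- the power of `X` makes the bound for the pole order nonnegative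
  obtain ⟨f, hf, hfI, hfA⟩ : ∃ f : k[X], f ≠ 0 ∧ algebraMap k[X] _ f ∈ Ip ∧
      0 ≤ A (inftyPlace h K) + f.natDegree := by
    obtain ⟨f, hf, hfI⟩ := exists_polynomial_mem h hIp0
    refine ⟨f * X ^ (-A (inftyPlace h K)).toNat, mul_ne_zero hf (pow_ne_zero _ X_ne_zero), ?_, ?_⟩
    · rw [map_mul]; exact Ip.mul_mem_right _ hfI
    · rw [natDegree_mul_X_pow _ hf]; push_cast; omega
  obtain ⟨n, hn⟩ := Int.eq_ofNat_of_zero_le hfA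
  set F := algebraMap k[X] (CoordRing k ε ρ σ) f with hF
  have hF0 : F ≠ 0 := by rwa [hF, Ne, FaithfulSMul.algebraMap_eq_zero_iff]
  have hιF0 : ι F ≠ 0 := by rwa [Ne, FaithfulSMul.algebraMap_eq_zero_iff]
  obtain ⟨J, hJ⟩ : Ip ∣ Ideal.span {F} := Ideal.dvd_span_singleton.2 hfI
  have hJ0 : J ≠ ⊥ := by
    rintro rfl
    rw [Ideal.mul_bot, Ideal.span_singleton_eq_bot] at hJ
    exact hF0 hJ
  have hFval : ∀ p : HeightOneSpectrum (CoordRing k ε ρ σ),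
      p.intValuation F ≤ WithZero.exp (-((A (primePlace K p)).toNat : ℤ)) := by
    intro p
    rw [p.intValuation_le_pow_iff_mem]
    exact prod_le_pow S hap p (hIp ▸ hfI)
  have hL : ∀ z ∈ poleLE k ε ρ σ n, z ∈ J * Im → ι z * (ι F)⁻¹ ∈ riemannRochSpace A := by
    intro z hz hzJ
    rw [mem_riemannRochSpace_iff h]
    constructor
    · rw [map_mul, map_inv₀, hF, val_inftyPlace_polynomial h K hf, ← WithZero.exp_neg]
      refine (mul_le_mul' ((val_inftyPlace_algebraMap_le_iff h K).2 hz) le_rfl).trans ?_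
      rw [← WithZero.exp_add, WithZero.exp_le_exp]
      omega
    · intro p
      obtain ⟨s, hs, hsv⟩ := exists_mem_prod_exp_le_intValuation S hap p
      rw [← hIp] at hs
      have hs0 : s ≠ 0 := by
        rintro rfl
        rw [map_zero] at hsv
        exact absurd hsv (not_le.2 WithZero.exp_pos)
      have hιs0 : ι s ≠ 0 := by rwa [Ne, FaithfulSMul.algebraMap_eq_zero_iff]
      have h1 : s * z ∈ Ideal.span {F} * Im := by
        rw [hJ, mul_assoc]
        exact Ideal.mul_mem_mul hs hzJ
      obtain ⟨t, ht, hst⟩ := Ideal.mem_span_singleton_mul.1 h1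
      have hu : ι z * (ι F)⁻¹ = ι t * (ι s)⁻¹ := by
        have := congrArg ι hst
        rw [map_mul, map_mul] at this
        field_simp
        linear_combination -this
      rw [hu, map_mul, map_inv₀, p.valuation_of_algebraMap, p.valuation_of_algebraMap]
      have htv : p.intValuation t ≤ WithZero.exp (-((-a p).toNat : ℤ)) := by
        rw [p.intValuation_le_pow_iff_mem]
        exact prod_le_pow S ham p (hIm ▸ ht)
      have hsv' : (p.intValuation s)⁻¹ ≤ WithZero.exp ((a p).toNat : ℤ) := by
        rw [← inv_inv (WithZero.exp ((a p).toNat : ℤ)), ← WithZero.exp_neg]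
        exact inv_anti₀ WithZero.exp_pos hsv
      refine (mul_le_mul' htv hsv').trans ?_
      rw [← WithZero.exp_add, WithZero.exp_le_exp]
      change _ ≤ a p
      omega
  have hfinL : Module.Finite k (riemannRochSpace A) := by
    have := finite_poleLE (k := k) (ε := ε) (ρ := ρ) (σ := σ) n
    let g : poleLE k ε ρ σ n →ₗ[k] K :=
      ((LinearMap.mulRight k (ι F)⁻¹).comp
        (IsScalarTower.toAlgHom k (CoordRing k ε ρ σ) K).toLinearMap).comp (Submodule.subtype _)
    have hle : riemannRochSpace A ≤ LinearMap.range g := by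
      intro u hu
      obtain ⟨z, hz, hzu⟩ := exists_eq_algebraMap_mul h hf hFval hn.symm hu
      refine ⟨⟨z, hz⟩, ?_⟩
      change ι z * (ι F)⁻¹ = u
      rw [hzu, mul_inv_cancel_right₀ hιF0]
    exact Submodule.finiteDimensional_of_le hle
  have hmain : 2 * n + 1 ≤
      Module.finrank k (CoordRing k ε ρ σ ⧸ J * Im) + Module.finrank k (riemannRochSpace A) := by
    have h1 := finite_poleLE (k := k) (ε := ε) (ρ := ρ) (σ := σ) n
    have h2 := hfin (J * Im) (mul_ne_zero hJ0 hIm0)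
    let q : poleLE k ε ρ σ n →ₗ[k] CoordRing k ε ρ σ ⧸ J * Im :=
      (Ideal.Quotient.mkₐ k (J * Im)).toLinearMap.comp (Submodule.subtype _)
    let g : LinearMap.ker q →ₗ[k] riemannRochSpace A :=
      (((LinearMap.mulRight k (ι F)⁻¹).comp
        (IsScalarTower.toAlgHom k (CoordRing k ε ρ σ) K).toLinearMap).comp
        ((Submodule.subtype _).comp (Submodule.subtype _))).codRestrict (riemannRochSpace A)
        (fun z => hL z.1.1 z.1.2 (Ideal.Quotient.eq_zero_iff_mem.1 z.2))
    have hg : Function.Injective g := by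
      intro z w hzw
      have h3 : ι z.1.1 * (ι F)⁻¹ = ι w.1.1 * (ι F)⁻¹ := congrArg Subtype.val hzw
      have h4 := IsFractionRing.injective (CoordRing k ε ρ σ) K
        (mul_right_cancel₀ (inv_ne_zero hιF0) h3)
      exact Subtype.ext (Subtype.ext h4)
    have h3 := LinearMap.finrank_le_finrank_of_injective hg
    have h4 := q.finrank_range_add_finrank_ker
    rw [finrank_poleLE] at h4
    have h5 := Submodule.finrank_le (LinearMap.range q)
    omega
  have hd1 := finrank_quotient_span_polynomial (k := k) (ε := ε) (ρ := ρ) (σ := σ) h hf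
  have hfin1 := hfin (Ip * J) (mul_ne_zero hIp0 hJ0)
  have hfin2 := hfin (J * Im) (mul_ne_zero hJ0 hIm0)
  rw [← hF, hJ, finrank_quotient_mul hIp0 hJ0] at hd1
  rw [finrank_quotient_mul hJ0 hIm0] at hmain
  have hdp : (Module.finrank k (CoordRing k ε ρ σ ⧸ Ip) : ℤ) =
      ∑ p ∈ S, ((a p).toNat : ℤ) * (Module.finrank k (CoordRing k ε ρ σ ⧸ p.asIdeal) : ℤ) := by
    rw [hIp, finrank_quotient_prod hfin]; push_cast; rfl
  have hdm : (Module.finrank k (CoordRing k ε ρ σ ⧸ Im) : ℤ) =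
      ∑ p ∈ S, ((-a p).toNat : ℤ) * (Module.finrank k (CoordRing k ε ρ σ ⧸ p.asIdeal) : ℤ) := by
    rw [hIm, finrank_quotient_prod hfin]; push_cast; rfl
  have hdeg : A.deg = A (inftyPlace h K) * 2 + (Module.finrank k (CoordRing k ε ρ σ ⧸ Ip) : ℤ)
      - (Module.finrank k (CoordRing k ε ρ σ ⧸ Im) : ℤ) := by
    rw [deg_eq h, hdp, hdm, add_sub_assoc, ← Finset.sum_sub_distrib]
    congr 1
    refine Finset.sum_congr rfl fun p _ => ?_
    rw [← sub_mul]
    congr 1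
    change a p = _
    omega
  omega

theorem mem_riemannRochSpace_zero (h : IsAnisotropic ε ρ σ) {u : K} :
    u ∈ riemannRochSpace (0 : Divisor k K) ↔ ∃ c : k, algebraMap k K c = u := by
  constructor
  · intro hu
    rw [mem_riemannRochSpace_iff h] at hu
    obtain ⟨c, rfl⟩ := HeightOneSpectrum.mem_integers_of_valuation_le_one K u hu.2
    have h1 := (val_inftyPlace_algebraMap_le_iff h K (c := c) (n := 0)).1 hu.1
    obtain ⟨a, rfl⟩ := poleOrder_eq_zero_iff.1 (Nat.le_zero.1 h1)
    exact ⟨a, IsScalarTower.algebraMap_apply _ _ _ a⟩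
  · rintro ⟨c, rfl⟩ P
    exact P.val_algebraMap_le_one c

/-- The value zero is attained at the divisor zero, since `L(0) = k`. -/
theorem hasGenus_zero (h : IsAnisotropic ε ρ σ) : HasGenus k K 0 := by
  constructor
  · refine ⟨0, ?_⟩
    have h1 : Module.finrank k (riemannRochSpace (0 : Divisor k K)) = 1 := by
      let e : riemannRochSpace (0 : Divisor k K) :=
        ⟨1, (mem_riemannRochSpace_zero K h).2 ⟨1, map_one _⟩⟩
      refine (finrank_eq_one_iff_of_nonzero' e fun he => ?_).2 fun ⟨u, hu⟩ => ?_
      · exact one_ne_zero (congrArg Subtype.val he)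
      · obtain ⟨c, rfl⟩ := (mem_riemannRochSpace_zero K h).1 hu
        exact ⟨c, Subtype.ext (Algebra.algebraMap_eq_smul_one c).symm⟩
    simp [h1, Divisor.deg]
  · rintro _ ⟨A, rfl⟩
    exact deg_sub_finrank_add_one_le h A

/-- The field `K` is spanned by `1` and `Y` over `k(X)`. An element which is algebraic over `k` is
integral at all places, and thus lies in `L(0) = k`. -/
theorem isFunctionFieldWithConstants (h : IsAnisotropic ε ρ σ) :
    IsFunctionFieldWithConstants k K := by
  have haeval : ∀ f : k[X], aeval (ι x) f = ι (algebraMap k[X] _ f) := fun f => by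
    rw [aeval_algebraMap_apply, aeval_x]
  constructor
  · refine ⟨ι x, ?_, ?_⟩
    · rw [transcendental_iff]
      intro f hf
      rwa [haeval, FaithfulSMul.algebraMap_eq_zero_iff, FaithfulSMul.algebraMap_eq_zero_iff] at hf
    · set L := IntermediateField.adjoin k {ι x} with hL
      have hmem : ∀ f : k[X], ι (algebraMap k[X] _ f) ∈ L := fun f => by
        rw [← haeval]
        exact IntermediateField.algebra_adjoin_le_adjoin k _ (aeval_mem_adjoin_singleton k _)
      classical
      refine ⟨⟨{1, ι y}, ?_⟩⟩
      rw [Submodule.eq_top_iff']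
      intro z
      obtain ⟨c, g, hg, rfl⟩ := exists_eq_div_polynomial h z
      rw [Finset.coe_insert, Finset.coe_singleton, Submodule.mem_span_pair]
      refine ⟨⟨_, div_mem (hmem c.re) (hmem g)⟩, ⟨_, div_mem (hmem c.im) (hmem g)⟩, ?_⟩
      conv_rhs => rw [eq_add_mul_y c]
      rw [IntermediateField.smul_def, IntermediateField.smul_def, map_add, map_mul, smul_eq_mul,
        smul_eq_mul]
      ring
  · intro z hz
    have hz' : IsIntegral k z := hz.isIntegral
    obtain ⟨c, hc⟩ := (mem_riemannRochSpace_zero K h (u := z)).1 fun P => by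
      simp only [Finsupp.coe_zero, Pi.zero_apply, WithZero.exp_zero]
      rw [← P.mem_ring_iff]
      have h1 : IsIntegral P.ring z := by
        obtain ⟨q, hq, hqz⟩ := hz'
        refine ⟨q.map (algebraMap k P.ring), hq.map _, ?_⟩
        rw [eval₂_map]
        exact hqz
      obtain ⟨r, rfl⟩ := IsIntegrallyClosed.isIntegral_iff.1 h1
      exact r.2
    exact ⟨c, hc⟩

end CoordRing

/-! ### Nonrationality and the presentation of the coordinate ring -/

namespace CoordRing

variable {k : Type u} [Field k] {ε ρ σ : k}

/-- A parametrization of the conic by rational functions would be a nontrivial zero of the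
anisotropic ternary form over `k[X]`. -/
theorem isEmpty_algEquiv_ratFunc (h : IsAnisotropic ε ρ σ) (K : Type w) [Field K]
    [Algebra (CoordRing k ε ρ σ) K] [Algebra k K] [IsScalarTower k (CoordRing k ε ρ σ) K] :
    IsEmpty (K ≃ₐ[k] RatFunc k) := by
  refine ⟨fun e => ?_⟩
  have heq := congrArg e (equation_field (ε := ε) (ρ := ρ) (σ := σ) K)
  simp only [map_add, map_mul, map_pow, map_zero, AlgEquiv.commutes] at heq
  obtain ⟨p, g, hg, hp⟩ := IsFractionRing.div_surjective (A := k[X])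
    (e (algebraMap (CoordRing k ε ρ σ) K x))
  obtain ⟨q, g', hg', hq⟩ := IsFractionRing.div_surjective (A := k[X])
    (e (algebraMap (CoordRing k ε ρ σ) K y))
  rw [← hp, ← hq] at heq
  have hg0 : algebraMap k[X] (RatFunc k) g ≠ 0 := by
    rw [Ne, FaithfulSMul.algebraMap_eq_zero_iff]; exact nonZeroDivisors.ne_zero hg
  have hg0' : algebraMap k[X] (RatFunc k) g' ≠ 0 := by
    rw [Ne, FaithfulSMul.algebraMap_eq_zero_iff]; exact nonZeroDivisors.ne_zero hg'
  have hC : ∀ a : k, algebraMap k (RatFunc k) a = algebraMap k[X] (RatFunc k) (C a) := fun a =>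
    IsScalarTower.algebraMap_apply k k[X] (RatFunc k) a
  rw [hC, hC, hC] at heq
  have h1 : algebraMap k[X] (RatFunc k) ((q * g) ^ 2 + C ε * (p * g') * (q * g)
      + C ρ * (p * g') ^ 2 + C σ * (g * g') ^ 2) = 0 := by
    simp only [map_add, map_mul, map_pow]
    field_simp at heq
    linear_combination heq
  rw [FaithfulSMul.algebraMap_eq_zero_iff] at h1
  exact mul_ne_zero (nonZeroDivisors.ne_zero hg) (nonZeroDivisors.ne_zero hg')
    (h.polynomial _ _ _ h1).2.2

section ConicRing

/-- The class of the variable `X` in `k[X, Y] / (Y² + ε X Y + ρ X² + σ)`. -/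
def conicX : ConicRing k ε ρ σ := Ideal.Quotient.mk _ (MvPolynomial.X 0)

/-- The class of the variable `Y` in `k[X, Y] / (Y² + ε X Y + ρ X² + σ)`. -/
def conicY : ConicRing k ε ρ σ := Ideal.Quotient.mk _ (MvPolynomial.X 1)

theorem conic_equation : (conicY : ConicRing k ε ρ σ) ^ 2 + algebraMap k _ ε * conicX * conicY
    + algebraMap k _ ρ * conicX ^ 2 + algebraMap k _ σ = 0 :=
  Ideal.Quotient.eq_zero_iff_mem.2 (Ideal.mem_span_singleton_self _)

variable (k ε ρ σ) in
/-- The evaluation map from the coordinate ring of the conic, given as a quotient of the polynomial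
ring in two variables, to its form as a quadratic algebra over `k[X]`. -/
def ofConicRing : ConicRing k ε ρ σ →ₐ[k] CoordRing k ε ρ σ :=
  Ideal.Quotient.liftₐ _ (MvPolynomial.aeval ![x, y]) fun a ha => by
    obtain ⟨b, rfl⟩ := Ideal.mem_span_singleton'.1 ha
    have h1 : (MvPolynomial.aeval ![x, y]) (MvPolynomial.X 1 ^ 2
        + MvPolynomial.C ε * MvPolynomial.X 0 * MvPolynomial.X 1
        + MvPolynomial.C ρ * MvPolynomial.X 0 ^ 2 + MvPolynomial.C σ : MvPolynomial (Fin 2) k) =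
        (0 : CoordRing k ε ρ σ) := by
      rw [← equation]
      simp
    rw [map_mul, h1, mul_zero]

theorem ofConicRing_conicX : ofConicRing k ε ρ σ conicX = x :=
  (MvPolynomial.aeval_X _ _)

theorem ofConicRing_conicY : ofConicRing k ε ρ σ conicY = y :=
  (MvPolynomial.aeval_X _ _)

theorem exists_eq_aeval_add (c : ConicRing k ε ρ σ) :
    ∃ p q : k[X], c = aeval conicX p + aeval conicX q * conicY := by
  obtain ⟨c, rfl⟩ := Ideal.Quotient.mk_surjective c
  induction c using MvPolynomial.induction_on with
  | C a => exact ⟨C a, 0, by rw [aeval_C, map_zero, zero_mul, add_zero]; rfl⟩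
  | add p q hp hq =>
    obtain ⟨p₁, q₁, h₁⟩ := hp
    obtain ⟨p₂, q₂, h₂⟩ := hq
    refine ⟨p₁ + p₂, q₁ + q₂, ?_⟩
    rw [map_add, h₁, h₂, map_add, map_add]
    ring
  | mul_X p i hp =>
    obtain ⟨p, q, h⟩ := hp
    rw [map_mul, h]
    fin_cases i
    · refine ⟨p * X, q * X, ?_⟩
      rw [map_mul, map_mul, aeval_X]
      change _ * conicX = _
      ring
    · refine ⟨-q * (C ρ * X ^ 2 + C σ), p - q * (C ε * X), ?_⟩
      simp only [map_mul, map_neg, map_add, map_sub, map_pow, aeval_X, aeval_C]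
      change _ * conicY = _
      linear_combination aeval conicX q * conic_equation (k := k) (ε := ε) (ρ := ρ) (σ := σ)

variable (k ε ρ σ) in
theorem ofConicRing_bijective : Function.Bijective (ofConicRing k ε ρ σ) := by
  have hval : ∀ p q : k[X], ofConicRing k ε ρ σ (aeval conicX p + aeval conicX q * conicY) =
      (⟨p, q⟩ : CoordRing k ε ρ σ) := by
    intro p q
    rw [map_add, map_mul, ← aeval_algHom_apply, ← aeval_algHom_apply, ofConicRing_conicX,
      ofConicRing_conicY, aeval_x, aeval_x]
    exact (eq_add_mul_y (⟨p, q⟩ : CoordRing k ε ρ σ)).symm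
  constructor
  · rw [injective_iff_map_eq_zero]
    intro c hc
    obtain ⟨p, q, rfl⟩ := exists_eq_aeval_add c
    rw [hval] at hc
    have hp : p = 0 := congrArg QuadraticAlgebra.re hc
    have hq : q = 0 := congrArg QuadraticAlgebra.im hc
    rw [hp, hq, map_zero, zero_mul, add_zero]
  · rintro ⟨p, q⟩
    exact ⟨_, hval p q⟩

end ConicRing

end CoordRing

/-! ### The quaternion algebra as a ring of matrices preserving a lattice -/

namespace CoordRing

variable {k : Type u} [Field k] {ε ρ σ : k}

/-- The standard quaternion basis in the matrix ring over the coordinate ring `C` of the conic. It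
describes the left multiplication by `i`, `j` and `k = i j` on the left ideal of `C ⊗ Q` generated
by `N = Y + ε X + X i + j`, an element of reduced norm zero, with respect to the `C`-basis
`N, i N`. The relation `j N = (Y - X i) N` gives the entries of the matrix of `j`. -/
def matrixBasis : QuaternionAlgebra.Basis (Matrix (Fin 2) (Fin 2) (CoordRing k ε ρ σ))
    (-ρ) (-ε) (-σ) where
  i := !![0, -algebraMap k _ ρ; 1, -algebraMap k _ ε]
  j := !![y, -(algebraMap k _ ε * y + algebraMap k _ ρ * x); -x, -y]
  k := !![algebraMap k _ ρ * x, algebraMap k _ ρ * y;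
    y + algebraMap k _ ε * x, -(algebraMap k _ ρ * x)]
  i_mul_i := by
    refine Matrix.ext fun i j => ?_
    fin_cases i <;> fin_cases j <;> simp <;> (try simp only [Algebra.smul_def]) <;> ring
  j_mul_j := by
    have := equation (k := k) (ε := ε) (ρ := ρ) (σ := σ)
    refine Matrix.ext fun i j => ?_
    fin_cases i <;> fin_cases j <;> simp <;> (try simp only [Algebra.smul_def]) <;>
      first | ring1 | linear_combination this
  i_mul_j := by
    refine Matrix.ext fun i j => ?_
    fin_cases i <;> fin_cases j <;> simp <;> (try simp only [Algebra.smul_def]) <;> ring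
  j_mul_i := by
    refine Matrix.ext fun i j => ?_
    fin_cases i <;> fin_cases j <;> simp <;> (try simp only [Algebra.smul_def]) <;> ring

variable (k ε ρ σ) in
/-- The homomorphism from the quaternion algebra to the matrix ring over the coordinate ring of
the conic. -/
def toMatrix : ℍ[k,-ρ,-ε,-σ] →ₐ[k] Matrix (Fin 2) (Fin 2) (CoordRing k ε ρ σ) :=
  matrixBasis.liftHom

theorem toMatrix_apply (q : ℍ[k,-ρ,-ε,-σ]) : toMatrix k ε ρ σ q =
    !![algebraMap k _ q.re + algebraMap k _ q.imJ * y + algebraMap k _ (q.imK * ρ) * x,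
      -algebraMap k _ (q.imI * ρ) - algebraMap k _ (q.imJ * ε) * y
        - algebraMap k _ (q.imJ * ρ) * x + algebraMap k _ (q.imK * ρ) * y;
      algebraMap k _ q.imI + algebraMap k _ (q.imK * ε - q.imJ) * x + algebraMap k _ q.imK * y,
      algebraMap k _ q.re - algebraMap k _ (q.imI * ε) - algebraMap k _ q.imJ * y
        - algebraMap k _ (q.imK * ρ) * x] := by
  have : toMatrix k ε ρ σ q = q.re • 1 + q.imI • matrixBasis.i + q.imJ • matrixBasis.j
      + q.imK • matrixBasis.k := by
    simp [toMatrix, QuaternionAlgebra.Basis.lift, Algebra.algebraMap_eq_smul_one]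
  rw [this]
  refine Matrix.ext fun i j => ?_
  fin_cases i <;> fin_cases j <;> simp [matrixBasis] <;> (try simp only [Algebra.smul_def]) <;> ring

section VertexMatrix

variable (K : Type w) [Field K] [Algebra (CoordRing k ε ρ σ) K]

local notation "ι" => algebraMap (CoordRing k ε ρ σ) K

variable (ε ρ σ) in
/-- The matrix whose columns are the coordinates of `N` and `j N = (Y - X i) N` with respect to
the basis `N, i N`, where `N` is as for `matrixBasis`. It represents the vertex given by the lattice
at infinity spanned by `N` and `j N`. -/
def vertexMatrix : Matrix (Fin 2) (Fin 2) K := !![1, ι y; 0, -ι x]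

variable (ε ρ σ) in
/-- The inverse of `vertexMatrix`. -/
def vertexMatrixInv : Matrix (Fin 2) (Fin 2) K := !![1, ι y / ι x; 0, -(ι x)⁻¹]

theorem vertexMatrix_mul_inv [IsFractionRing (CoordRing k ε ρ σ) K] (h : IsAnisotropic ε ρ σ) :
    vertexMatrix ε ρ σ K * vertexMatrixInv ε ρ σ K = 1 := by
  have hx := field_x_ne_zero K h
  rw [vertexMatrix, vertexMatrixInv, Matrix.mul_fin_two, Matrix.one_fin_two]
  congr <;> field_simp <;> ring

theorem vertexMatrix_conj (m : Matrix (Fin 2) (Fin 2) K) :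
    vertexMatrixInv ε ρ σ K * m *
        vertexMatrix ε ρ σ K =
      !![m 0 0 + ι y / ι x * m 1 0,
        (m 0 0 + ι y / ι x * m 1 0) * ι y - (m 0 1 + ι y / ι x * m 1 1) * ι x;
        -((ι x)⁻¹ * m 1 0),
        (ι x)⁻¹ * (m 1 1 * ι x - m 1 0 * ι y)] := by
  refine Matrix.ext fun i j => ?_
  fin_cases i <;> fin_cases j <;>
    simp [vertexMatrix, vertexMatrixInv, Matrix.mul_apply, Matrix.vecMul, dotProduct,
      Fin.sum_univ_two] <;>
    ring

end VertexMatrix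

section Infinity

variable (h : IsAnisotropic ε ρ σ) (K : Type w) [Field K] [Algebra (CoordRing k ε ρ σ) K]
  [IsFractionRing (CoordRing k ε ρ σ) K] [Algebra k K] [IsScalarTower k (CoordRing k ε ρ σ) K]

local notation "ι" => algebraMap (CoordRing k ε ρ σ) K

/-- The function `1 / X`, which vanishes at infinity. -/
def invX : (inftyPlace h K).ring := ⟨(ι x)⁻¹, by
  rw [Place.mem_ring_iff, map_inv₀, val_inftyPlace_x, ← WithZero.exp_neg, ← WithZero.exp_zero,
    WithZero.exp_le_exp]
  norm_num⟩

/-- The function `Y / X`, which is integral at infinity. -/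
def slope : (inftyPlace h K).ring :=
  ⟨ι y / ι x, (Place.mem_ring_iff _).2 (val_inftyPlace_y_div_x_le_one h K)⟩

theorem slope_equation : slope h K ^ 2 + algebraMap k _ ε * slope h K + algebraMap k _ ρ
    + algebraMap k _ σ * invX h K ^ 2 = 0 := by
  have hx := field_x_ne_zero K h
  have := equation_field (k := k) (ε := ε) (ρ := ρ) (σ := σ) K
  apply Subtype.ext
  push_cast
  rw [Place.coe_algebraMap, Place.coe_algebraMap, Place.coe_algebraMap]
  simp only [slope, invX]
  field_simp
  linear_combination this

/-- The standard quaternion basis in the matrix ring over the local ring at infinity. With `N` as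
for `matrixBasis`, it describes the left multiplication by `i`, `j` and `k = i j` with respect to
the basis `N, j N`. -/
def inftyMatrixBasis : QuaternionAlgebra.Basis (Matrix (Fin 2) (Fin 2) (inftyPlace h K).ring)
    (-ρ) (-ε) (-σ) where
  i := !![slope h K, -(algebraMap k _ σ * invX h K);
    -invX h K, -(slope h K + algebraMap k _ ε)]
  j := !![0, -algebraMap k _ σ; 1, 0]
  k := !![-(algebraMap k _ σ * invX h K), -(algebraMap k _ σ * slope h K);
    -(slope h K + algebraMap k _ ε), algebraMap k _ σ * invX h K]
  i_mul_i := by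
    have := slope_equation h K
    refine Matrix.ext fun i j => ?_
    fin_cases i <;> fin_cases j <;> simp <;> (try simp only [Algebra.smul_def])
    · linear_combination this
    · ring
    · ring
    · linear_combination this
  j_mul_j := by
    refine Matrix.ext fun i j => ?_
    fin_cases i <;> fin_cases j <;> simp [Algebra.smul_def]
  i_mul_j := by
    refine Matrix.ext fun i j => ?_
    fin_cases i <;> fin_cases j <;> simp <;> ring
  j_mul_i := by
    refine Matrix.ext fun i j => ?_
    fin_cases i <;> fin_cases j <;> simp <;> (try simp only [Algebra.smul_def]) <;> ring

/-- The homomorphism from the quaternion algebra to the matrix ring over the local ring at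
infinity. -/
def toInftyMatrix : ℍ[k,-ρ,-ε,-σ] →ₐ[k] Matrix (Fin 2) (Fin 2) (inftyPlace h K).ring :=
  (inftyMatrixBasis h K).liftHom

theorem toInftyMatrix_apply (q : ℍ[k,-ρ,-ε,-σ]) : toInftyMatrix h K q =
    !![algebraMap k _ q.re + algebraMap k _ q.imI * slope h K
        - algebraMap k _ (q.imK * σ) * invX h K,
      -(algebraMap k _ (q.imI * σ) * invX h K) - algebraMap k _ (q.imJ * σ)
        - algebraMap k _ (q.imK * σ) * slope h K;
      algebraMap k _ q.imJ - algebraMap k _ q.imI * invX h K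
        - algebraMap k _ q.imK * (slope h K + algebraMap k _ ε),
      algebraMap k _ q.re - algebraMap k _ q.imI * (slope h K + algebraMap k _ ε)
        + algebraMap k _ (q.imK * σ) * invX h K] := by
  have : toInftyMatrix h K q = q.re • 1 + q.imI • (inftyMatrixBasis h K).i
      + q.imJ • (inftyMatrixBasis h K).j + q.imK • (inftyMatrixBasis h K).k := by
    simp [toInftyMatrix, QuaternionAlgebra.Basis.lift, Algebra.algebraMap_eq_smul_one]
  rw [this]
  refine Matrix.ext fun i j => ?_
  fin_cases i <;> fin_cases j <;> simp [inftyMatrixBasis] <;>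
    (try simp only [Algebra.smul_def]) <;> ring

/-- The matrices over `C` and those over the local ring at infinity describe the same action with
respect to two bases. -/
theorem toMatrix_mul_vertexMatrix (q : ℍ[k,-ρ,-ε,-σ]) :
    (ι).mapMatrix (toMatrix k ε ρ σ q) * vertexMatrix ε ρ σ K =
      vertexMatrix ε ρ σ K *
        (inftyPlace h K).ring.subtype.mapMatrix (toInftyMatrix h K q) := by
  have hx := field_x_ne_zero K h
  have hc := equation_field (k := k) (ε := ε) (ρ := ρ) (σ := σ) K
  rw [toMatrix_apply, toInftyMatrix_apply, vertexMatrix]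
  refine Matrix.ext fun i j => ?_
  fin_cases i <;> fin_cases j <;>
    simp [slope, invX, Place.coe_algebraMap, ← IsScalarTower.algebraMap_apply, Matrix.mul_apply,
      Fin.sum_univ_two] <;> field_simp
  · linear_combination algebraMap k K q.imK * hc
  · linear_combination (algebraMap k K q.imI + algebraMap k K q.imJ * ι x) * hc
  · ring
  · linear_combination algebraMap k K q.imK * hc

/-- An element of `C` which is integral at infinity is constant. -/
theorem exists_eq_algebraMap_of_mem {c : CoordRing k ε ρ σ} (hc : ι c ∈ (inftyPlace h K).ring) :
    ∃ a : k, c = algebraMap k _ a := by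
  rw [← poleOrder_eq_zero_iff, ← Nat.le_zero, ← val_inftyPlace_algebraMap_le_iff h K]
  rw [Place.mem_ring_iff] at hc
  simpa using hc

theorem exists_eq_of_poleOrder_le_one {c : CoordRing k ε ρ σ} (hc : c.poleOrder ≤ 1) :
    ∃ c₀ c₁ c₂ : k, c = algebraMap k _ c₀ + algebraMap k _ c₁ * x + algebraMap k _ c₂ * y := by
  obtain ⟨h1, h2⟩ := poleOrder_le_iff.1 hc
  have h3 : c.im.natDegree ≤ 0 := by
    by_cases h0 : c.im = 0
    · simp [h0]
    · rw [natDegree_X_mul h0] at h2; omega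
  refine ⟨c.re.coeff 0, c.re.coeff 1, c.im.coeff 0, QuadraticAlgebra.ext ?_ ?_⟩
  · conv_lhs => rw [eq_X_add_C_of_natDegree_le_one h1]
    simp [algebraMap_eq_mk, x, y]
    ring
  · conv_lhs => rw [eq_C_of_natDegree_le_zero h3]
    simp [algebraMap_eq_mk, x, y]

theorem eq_zero_of_mul_y_sub_mul_x_eq {a e : k} {b : CoordRing k ε ρ σ}
    (hb : algebraMap k _ a * y - b * x = algebraMap k _ e) : a = 0 ∧ b = 0 := by
  have h1 := congrArg QuadraticAlgebra.re hb
  have h2 := congrArg QuadraticAlgebra.im hb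
  simp [algebraMap_eq_mk, x, y] at h1 h2
  have h3 : a = 0 := by simpa using congrArg (coeff · 0) h2
  have h4 : e = 0 := by simpa using (congrArg (coeff · 0) h1).symm
  refine ⟨h3, QuadraticAlgebra.ext ?_ ?_⟩
  · simpa [h4] using h1
  · simpa [h3] using h2

/-- A matrix over `C` which preserves the lattice at infinity lies in the quaternion algebra: its
entries have bounded poles, so that it lies in a space of dimension four over `k`. -/
theorem exists_toMatrix_eq {m : Matrix (Fin 2) (Fin 2) (CoordRing k ε ρ σ)}
    (hm : ∀ i j, (vertexMatrixInv ε ρ σ K * (ι).mapMatrix m *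
      vertexMatrix ε ρ σ K) i j ∈ (inftyPlace h K).ring) :
    ∃ q, toMatrix k ε ρ σ q = m := by
  have hx := field_x_ne_zero K h
  have hG := mul_eq_one_comm.1 (vertexMatrix_mul_inv K h)
  -- The lower left entry has at most a simple pole, so that it agrees with that of
  -- an element of the quaternion algebra.
  obtain ⟨q, hq⟩ : ∃ q, toMatrix k ε ρ σ q 1 0 = m 1 0 := by
    obtain ⟨c₀, c₁, c₂, hc⟩ : ∃ c₀ c₁ c₂ : k, m 1 0 = algebraMap k _ c₀ + algebraMap k _ c₁ * x
        + algebraMap k _ c₂ * y := by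
      apply exists_eq_of_poleOrder_le_one
      rw [← val_inftyPlace_algebraMap_le_iff h K]
      have h10 := hm 1 0
      simp only [vertexMatrix_conj] at h10
      simp at h10
      rw [Place.mem_ring_iff, map_mul, map_inv₀, val_inftyPlace_x] at h10
      have h0 : (WithZero.exp (1 : ℤ)) ≠ 0 := WithZero.exp_ne_zero
      rw [inv_mul_le_iff₀ (zero_lt_iff.2 h0), mul_one] at h10
      exact_mod_cast h10
    refine ⟨⟨0, c₀, c₂ * ε - c₁, c₂⟩, ?_⟩
    rw [hc, toMatrix_apply]
    simp
  obtain ⟨n, hn⟩ : ∃ n, n = m - toMatrix k ε ρ σ q := ⟨_, rfl⟩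
  have hn' : ∀ i j, (vertexMatrixInv ε ρ σ K * (ι).mapMatrix n *
      vertexMatrix ε ρ σ K) i j ∈ (inftyPlace h K).ring := by
    intro i j
    rw [hn, map_sub, mul_sub, sub_mul, mul_assoc _ ((ι).mapMatrix (toMatrix k ε ρ σ q)),
      toMatrix_mul_vertexMatrix h, ← mul_assoc, hG, one_mul]
    exact sub_mem (hm i j) (toInftyMatrix h K q i j).2
  have hn10 : n 1 0 = 0 := by rw [hn, Matrix.sub_apply, hq, sub_self]
  suffices ∃ a : k, n = algebraMap k _ a by
    obtain ⟨a, ha⟩ := this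
    refine ⟨algebraMap k _ a + q, ?_⟩
    rw [map_add, AlgHom.commutes, ← ha, hn, sub_add_cancel]
  have h00 := hn' 0 0
  have h01 := hn' 0 1
  have h11 := hn' 1 1
  simp only [vertexMatrix_conj] at h00 h01 h11
  simp [hn10] at h00 h01 h11
  rw [mul_comm (ι (n 1 1)), inv_mul_cancel_left₀ hx] at h11
  obtain ⟨a, ha⟩ := exists_eq_algebraMap_of_mem h K h00
  obtain ⟨d, hd⟩ := exists_eq_algebraMap_of_mem h K h11
  obtain ⟨e, he⟩ := exists_eq_algebraMap_of_mem h K (c := n 0 0 * y - n 0 1 * x - n 1 1 * y) (by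
    convert h01 using 1
    simp only [map_sub, map_mul]
    field_simp
    ring)
  obtain ⟨h1, h2⟩ := eq_zero_of_mul_y_sub_mul_x_eq (a := a - d) (b := n 0 1) (e := e) (by
    rw [← he, ha, hd, map_sub]
    ring)
  refine ⟨a, Matrix.ext fun i j => ?_⟩
  rw [Matrix.algebraMap_matrix_apply]
  fin_cases i <;> fin_cases j
  · simp [ha]
  · simp [h2]
  · simp [hn10]
  · simp [hd, sub_eq_zero.1 h1]

end Infinity

end CoordRing

/-! ### The stabilizer of the vertex -/

section VertexSubgroup

variable {k : Type u} {K : Type w} [Field k] [Field K] [Algebra k K]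

theorem mem_completionIntegers_iff (P : Place k K) (z : K) :
    algebraMap K (Completion P) z ∈ CompletionIntegers P ↔ z ∈ P.ring := by
  rw [P.mem_ring_iff, HeightOneSpectrum.mem_adicCompletionIntegers,
    ← HeightOneSpectrum.valuedAdicCompletion_eq_valuation']
  rfl

theorem valued_algebraMap (P : Place k K) (z : K) :
    Valued.v (algebraMap K (Completion P) z) = P.val z :=
  HeightOneSpectrum.valuedAdicCompletion_eq_valuation' _ _

theorem isUnit_completionIntegers_iff (P : Place k K) (u : CompletionIntegers P) :
    IsUnit u ↔ Valued.v (u : Completion P) = 1 :=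
  Valuation.Integers.isUnit_iff_valuation_eq_one
    (Valuation.integer.integers (Valued.v : Valuation (Completion P) _))

/-- Membership in `Z_∞ GL₂(𝒪_∞)` for a matrix whose determinant is a unit at the place: the scalar
factor is a unit, too. -/
theorem map_mem_vertexSubgroup_iff (P : Place k K) {M : GL (Fin 2) K}
    (hdet : P.val M.val.det = 1) :
    Matrix.GeneralLinearGroup.map (algebraMap K (Completion P)) M ∈ vertexSubgroup P ↔
      ∀ i j, M i j ∈ P.ring := by
  have hn : (Matrix.GeneralLinearGroup.scalar (Fin 2) (R := Completion P)).range.Normal :=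
    ⟨by
      rintro _ ⟨z, rfl⟩ g
      exact ⟨z, by rw [← Matrix.GeneralLinearGroup.scalar_commute, mul_inv_cancel_right]⟩⟩
  rw [vertexSubgroup, Subgroup.mem_sup_of_normal_left]
  constructor
  · rintro ⟨_, ⟨z, rfl⟩, _, ⟨U, rfl⟩, hU⟩
    have hU1 : Valued.v ((U.val.det : CompletionIntegers P) : Completion P) = 1 :=
      (isUnit_completionIntegers_iff P _).1 ((Matrix.isUnit_iff_isUnit_det _).1 U.isUnit)
    have hz : Valued.v (z : Completion P) = 1 := by
      have h1 := congrArg (fun g : GL (Fin 2) (Completion P) => Valued.v g.val.det) hU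
      simp only [Units.val_mul, Matrix.det_mul, map_mul, Matrix.GeneralLinearGroup.coe_scalar,
        Matrix.scalar_apply, Matrix.det_diagonal, Finset.prod_const, Finset.card_univ,
        Fintype.card_fin, Matrix.GeneralLinearGroup.map, Units.coe_map, MonoidHom.coe_coe,
        RingHom.toMonoidHom_eq_coe, ← RingHom.map_det, valued_algebraMap, hdet, map_pow] at h1
      rw [ValuationSubring.coe_subtype, hU1, mul_one] at h1
      simpa using h1
    intro i j
    have h1 := congrArg (fun g : GL (Fin 2) (Completion P) => g i j) hU
    simp [Matrix.GeneralLinearGroup.map_apply] at h1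
    rw [← mem_completionIntegers_iff, ← h1]
    exact mul_mem (by exact hz.le) (U i j).2
  · intro hM
    let N : Matrix (Fin 2) (Fin 2) (CompletionIntegers P) := fun i j =>
      ⟨algebraMap K (Completion P) (M i j), (mem_completionIntegers_iff P _).2 (hM i j)⟩
    have hN : (CompletionIntegers P).subtype.mapMatrix N =
      (algebraMap K (Completion P)).mapMatrix M.val := rfl
    have hNdet : ((N.det : CompletionIntegers P) : Completion P) = algebraMap K _ M.val.det := by
      rw [← ValuationSubring.coe_subtype, RingHom.map_det, hN, RingHom.map_det]
    have hu : IsUnit N.det := by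
      rw [isUnit_completionIntegers_iff, hNdet, valued_algebraMap, hdet]
    refine ⟨1, one_mem _, _, ⟨Matrix.GeneralLinearGroup.mk'' N hu, rfl⟩, ?_⟩
    rw [one_mul]
    exact Units.ext hN

end VertexSubgroup

namespace CoordRing

variable {k : Type u} [Field k] {ε ρ σ : k} (h : IsAnisotropic ε ρ σ) (K : Type w) [Field K]
  [Algebra (CoordRing k ε ρ σ) K] [IsFractionRing (CoordRing k ε ρ σ) K] [Algebra k K]
  [IsScalarTower k (CoordRing k ε ρ σ) K]

/-- The element of `GL₂(K)` given by `vertexMatrix`. -/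
def vertexGL : GL (Fin 2) K where
  val := vertexMatrix ε ρ σ K
  inv := vertexMatrixInv ε ρ σ K
  val_inv := vertexMatrix_mul_inv K h
  inv_val := mul_eq_one_comm.1 (vertexMatrix_mul_inv K h)

/-- The vertex of the tree given by `vertexMatrix`. -/
def vertex : TreeVertex (inftyPlace h K) :=
  (Matrix.GeneralLinearGroup.map (algebraMap K _) (vertexGL h K) :
    GL (Fin 2) (Completion (inftyPlace h K)))

variable [IsDedekindDomain (CoordRing k ε ρ σ)]

/-- The stabilizer of the vertex in `GL₂(C)` consists of the matrices in the image of the quaternion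
algebra. -/
theorem map_mem_vertexStabilizer_iff {m : GL (Fin 2) (CoordRing k ε ρ σ)} :
    Matrix.GeneralLinearGroup.map (integersAwayEquiv h K : CoordRing k ε ρ σ →+* _) m ∈
        vertexStabilizer (inftyPlace h K) (vertex h K) ↔
      ∃ q, toMatrix k ε ρ σ q = m.val := by
  have h1 : toGLCompletion (inftyPlace h K) (Matrix.GeneralLinearGroup.map
        (integersAwayEquiv h K : CoordRing k ε ρ σ →+* _) m) =
      Matrix.GeneralLinearGroup.map (algebraMap K _)
        (Matrix.GeneralLinearGroup.map (algebraMap (CoordRing k ε ρ σ) K) m) := rfl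
  have hdet : (inftyPlace h K).val ((vertexGL h K)⁻¹ *
      (Matrix.GeneralLinearGroup.map (algebraMap (CoordRing k ε ρ σ) K) m * vertexGL h K)).val.det
        = 1 := by
    have h2 : ((vertexGL h K)⁻¹ * (Matrix.GeneralLinearGroup.map
        (algebraMap (CoordRing k ε ρ σ) K) m * vertexGL h K)).val.det =
          algebraMap (CoordRing k ε ρ σ) K m.val.det := by
      rw [Units.val_mul, Units.val_mul, Matrix.det_mul, Matrix.det_mul, mul_left_comm,
        ← Matrix.det_mul, Units.inv_mul, Matrix.det_one, mul_one, RingHom.map_det]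
      rfl
    rw [h2, val_inftyPlace, fieldInftyValuation_algebraMap]
    exact inftyValuation_eq_one_of_isUnit h ((Matrix.isUnit_iff_isUnit_det _).1 m.isUnit)
  rw [vertexStabilizer, Subgroup.mem_comap, h1, MulAction.mem_stabilizer_iff, vertex,
    MulAction.Quotient.smul_coe, eq_comm, QuotientGroup.eq, smul_eq_mul,
    ← Matrix.GeneralLinearGroup.map_mul, ← Matrix.GeneralLinearGroup.map_inv,
    ← Matrix.GeneralLinearGroup.map_mul, map_mem_vertexSubgroup_iff _ hdet, ← mul_assoc]
  constructor
  · exact exists_toMatrix_eq h K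
  · rintro ⟨q, hq⟩ i j
    have h2 : ((vertexGL h K)⁻¹ * Matrix.GeneralLinearGroup.map
        (algebraMap (CoordRing k ε ρ σ) K) m * vertexGL h K).val =
          (inftyPlace h K).ring.subtype.mapMatrix (toInftyMatrix h K q) := by
      rw [mul_assoc, Units.val_mul, Units.val_mul, Units.inv_mul_eq_iff_eq_mul]
      refine Eq.trans ?_ (toMatrix_mul_vertexMatrix h K q)
      rw [hq]
      rfl
    rw [h2]
    exact (toInftyMatrix h K q i j).2

/-- If the quaternion algebra is a division algebra, then all its elements that become invertible
matrices are units, so that its unit group is the stabilizer of the vertex. -/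
theorem nonempty_vertexStabilizer_mulEquiv
    (hu : ∀ q : ℍ[k,-ρ,-ε,-σ], q ≠ 0 → IsUnit q) :
    Nonempty (vertexStabilizer (inftyPlace h K) (vertex h K) ≃* ℍ[k,-ρ,-ε,-σ]ˣ) := by
  have := isDomain h
  let e : GL (Fin 2) (CoordRing k ε ρ σ) ≃* GL (Fin 2) (integersAway (inftyPlace h K)) :=
    Units.mapEquiv (RingEquiv.mapMatrix (integersAwayEquiv h K).toRingEquiv).toMulEquiv
  have he : ∀ m, e m = Matrix.GeneralLinearGroup.map
    (integersAwayEquiv h K : CoordRing k ε ρ σ →+* _) m := fun _ => rfl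
  let θ : ℍ[k,-ρ,-ε,-σ]ˣ →* GL (Fin 2) (integersAway (inftyPlace h K)) :=
    e.toMonoidHom.comp (Units.map (toMatrix k ε ρ σ : _ →* _))
  have hinj : ∀ q, toMatrix k ε ρ σ q = 0 → q = 0 := by
    intro q hq
    by_contra h0
    exact ((hu q h0).map (toMatrix k ε ρ σ)).ne_zero hq
  have hθ : Function.Injective θ := by
    refine e.injective.comp (Units.map_injective ?_)
    exact (injective_iff_map_eq_zero (toMatrix k ε ρ σ)).2 hinj
  have hr : θ.range = vertexStabilizer (inftyPlace h K) (vertex h K) := by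
    ext g
    obtain ⟨m, rfl⟩ := e.surjective g
    rw [he, map_mem_vertexStabilizer_iff, ← he]
    constructor
    · rintro ⟨q, hq⟩
      exact ⟨q, congrArg Units.val (e.injective hq)⟩
    · rintro ⟨q, hq⟩
      have h0 : q ≠ 0 := by
        rintro rfl
        rw [map_zero] at hq
        exact m.isUnit.ne_zero hq.symm
      exact ⟨(hu q h0).unit, congrArg e (Units.ext hq)⟩
  exact ⟨((MonoidHom.ofInjective hθ).trans (MulEquiv.subgroupCongr hr)).symm⟩

end CoordRing

/-- The function field of the conic `y² + ε x y + ρ x² + σ z² = 0` has the required properties with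
respect to the quaternion algebra with the parameters `-ρ, -ε, -σ`. -/
theorem exists_functionField {k : Type u} [Field k] {Q : Type v} [Ring Q] [Algebra k Q]
    (hu : ∀ a : Q, a ≠ 0 → IsUnit a) {ε ρ σ : k} (e : Q ≃ₐ[k] ℍ[k,-ρ,-ε,-σ])
    (hdisc : IsAnisotropic ε ρ σ → ε ^ 2 - 4 * ρ ≠ 0) :
    ∃ (K : Type u) (_ : Field K) (_ : Algebra k K) (infty : Place k K) (v : TreeVertex infty),
      IsFunctionFieldWithConstants k K ∧ HasGenus k K 0 ∧ IsEmpty (K ≃ₐ[k] RatFunc k) ∧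
      infty.degree = 2 ∧ Nonempty (vertexStabilizer infty v ≃* Qˣ) ∧
      Nonempty (integersAway infty ≃ₐ[k] ConicRing k ε ρ σ) := by
  have hu' : ∀ q : ℍ[k,-ρ,-ε,-σ], q ≠ 0 → IsUnit q := fun q hq => by
    have := (hu (e.symm q) (by simpa using hq)).map e
    rwa [AlgEquiv.apply_symm_apply] at this
  have h := isAnisotropic_of_division hu'
  have := CoordRing.isDomain h
  have := CoordRing.isDedekindDomain h (hdisc h)
  let K := FractionRing (CoordRing k ε ρ σ)
  obtain ⟨f⟩ := CoordRing.nonempty_vertexStabilizer_mulEquiv h K hu'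
  exact ⟨K, inferInstance, inferInstance, CoordRing.inftyPlace h K, CoordRing.vertex h K,
    CoordRing.isFunctionFieldWithConstants K h, CoordRing.hasGenus_zero K h,
    CoordRing.isEmpty_algEquiv_ratFunc h K, CoordRing.degree_inftyPlace h K,
    ⟨f.trans (Units.mapEquiv e.symm.toMulEquiv)⟩,
    ⟨(CoordRing.integersAwayEquiv h K).symm.trans
      (AlgEquiv.ofBijective _ (CoordRing.ofConicRing_bijective k ε ρ σ)).symm⟩⟩

end DrinfeldModular

end

theorem theorem2p11 (k : Type u) [Field k]
    (Q : Type v) [Ring Q] [Algebra k Q] [Algebra.IsCentral k Q] [IsSimpleRing Q]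
    (hdim : Module.finrank k Q = 4)
    (hnonsplit : IsEmpty (Q ≃ₐ[k] Matrix (Fin 2) (Fin 2) k)) :
    ∃ (K : Type u) (_ : Field K) (_ : Algebra k K) (infty : DrinfeldModular.Place k K)
      (v : DrinfeldModular.TreeVertex infty),
      DrinfeldModular.IsFunctionFieldWithConstants k K ∧
      DrinfeldModular.HasGenus k K 0 ∧
      IsEmpty (K ≃ₐ[k] RatFunc k) ∧
      infty.degree = 2 ∧
      Nonempty (DrinfeldModular.vertexStabilizer infty v ≃* Qˣ) ∧
      (ringChar k ≠ 2 → ∃ ρ σ : k,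
        Nonempty (Q ≃ₐ[k] QuaternionAlgebra k (-ρ) 0 (-σ)) ∧
        Nonempty (DrinfeldModular.integersAway infty ≃ₐ[k] DrinfeldModular.ConicRing k 0 ρ σ)) ∧
      (ringChar k = 2 → ∃ ρ σ : k,
        Nonempty (Q ≃ₐ[k] QuaternionAlgebra k ρ 1 σ) ∧
        Nonempty (DrinfeldModular.integersAway infty ≃ₐ[k] DrinfeldModular.ConicRing k 1 ρ σ)) := by
  have hu := DrinfeldModular.isUnit_of_nonsplit hdim hnonsplit
  by_cases hchar : ringChar k = 2
  · have hk : CharP k 2 := ringChar.eq_iff.1 hchar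
    have h2 : (2 : k) = 0 := CharTwo.two_eq_zero
    obtain ⟨ρ, σ, hQ⟩ :=
      DrinfeldModular.exists_quaternionAlgebra_equiv_of_two_eq_zero hdim hu h2
    have hQ' : Nonempty (Q ≃ₐ[k] QuaternionAlgebra k (-ρ) (-1) (-σ)) := by
      rwa [CharTwo.neg_eq, CharTwo.neg_eq, CharTwo.neg_eq]
    obtain ⟨K, hK, hkK, P, v, h⟩ :=
      DrinfeldModular.exists_functionField hu hQ'.some (fun _ => by
      rw [show (4 : k) = 2 * 2 by norm_num, h2]
      simp)
    exact ⟨K, hK, hkK, P, v, h.1, h.2.1, h.2.2.1, h.2.2.2.1, h.2.2.2.2.1,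
      fun h0 => absurd hchar h0, fun _ => ⟨ρ, σ, hQ, h.2.2.2.2.2⟩⟩
  · have h2 : (2 : k) ≠ 0 := Ring.two_ne_zero hchar
    obtain ⟨α, γ, hQ⟩ :=
      DrinfeldModular.exists_quaternionAlgebra_equiv_of_two_ne_zero hdim hu h2
    have hQ' : Nonempty (Q ≃ₐ[k] QuaternionAlgebra k (-(-α)) 0 (-(-γ))) := by
      rwa [neg_neg, neg_neg]
    have hQ'' : Nonempty (Q ≃ₐ[k] QuaternionAlgebra k (-(-α)) (-0) (-(-γ))) := by
      rwa [neg_zero]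
    obtain ⟨K, hK, hkK, P, v, h⟩ :=
      DrinfeldModular.exists_functionField hu hQ''.some (fun h => by
      -- If `ρ = 0` then the form vanishes at `(0, 1, 0)`.
      intro h0
      have h4 : (4 : k) ≠ 0 := by
        rw [show (4 : k) = 2 * 2 by norm_num]
        exact mul_ne_zero h2 h2
      have hα : α = 0 := by simpa [h4] using h0
      exact one_ne_zero (h 0 1 0 (by simp [hα])).2.1)
    exact ⟨K, hK, hkK, P, v, h.1, h.2.1, h.2.2.1, h.2.2.2.1, h.2.2.2.2.1,
      fun _ => ⟨-α, -γ, hQ', h.2.2.2.2.2⟩, fun h0 => absurd h0 hchar⟩
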